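/- Let $(\mathcal F,\oplus,+)$ be a commutative perfect Banach semifield of characteristic $1$ with absorbing element $E$. That is: $\oplus$ is a commutative, associative, idempotent law on $\mathcal F$; $(\mathcal F,+)$ is an abelian group, $\mathcal F\neq\{0\}$, and $X+(Y\oplus Z)=(X+Y)\oplus(X+Z)$; for every integer $n\ge 1$ the map $X\mapsto nX$ is surjective (it is then bijective, so that $(\mathcal F,+)$ is a $\mathbb Q$-vector space); for the order $X\le Y\Leftrightarrow X\oplus Y=Y$, every $X\in\mathcal F$ satisfies $-tE\le X\le tE$ for some $t\in\mathbb Q_{\ge 0}$; with $r(X)$ the infimum of these $t$, one has $r(X)=0$ if and only if $X=0$; and $\mathcal F$ is complete for the distance $r(X-Y)$. By continuity $\mathcal F$ is then a real vector space. Let $S_E(\mathcal F)$ be the set of maps $\varphi:\mathcal F\to\mathbb R$ with $\varphi(X\oplus Y)=\max(\varphi(X),\varphi(Y))$, $\varphi(X+Y)=\varphi(X)+\varphi(Y)$ and $\varphi(E)=1$, with the weakest topology making all the maps $\varphi\mapsto\varphi(X)$, $X\in\mathcal F$, continuous. Let $S(\alpha)=-\alpha\log\alpha-(1-\alpha)\log(1-\alpha)$.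 For $X,Y\in\mathcal F$ the least upper bound $$X+_wY=\bigoplus_{\alpha\in[0,1]}\bigl(S(\alpha)E+\alpha X+(1-\alpha)Y\bigr)$$ exists, and $\mathcal F\cup\{-\infty\}$, with $+_w$ as addition, $+$ as multiplication and $-\infty$ as zero, is a commutative semiring; it contains $\mathbb R_{\ge 0}$ through $0\mapsto-\infty$ and $s\mapsto(\log s)E$ for $s>0$. Let $W(\mathcal F,E)$ be its Grothendieck ring, a real algebra through this inclusion, and let $[x]\in W(\mathcal F,E)$ be the class of $x\in\mathcal F\cup\{-\infty\}$. Put $|x|=\inf\{s\in\mathbb R_{\ge 0}: x\le s\}$ and endow $W(\mathcal F,E)$ with the seminorm $$\|\xi\|=\inf\{|x|+|y| : \xi=[x]-[y]\}.$$ Its completion $\overline W(\mathcal F,E)$ is a real Banach algebra, the Connes–Consani Banach algebra of Witt vectors of $(\mathcal F,E)$. Then the spectrum of $\overline W(\mathcal F,E)\otimes_{\mathbb R}\mathbb C$, i.e. the set of its unital algebra homomorphisms to $\mathbb C$ with the weakest topology making all evaluations continuous, coincides with $S_E(\mathcal F)$: there is a homeomorphism $\varphi\mapsto\chi_\varphi$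 from $S_E(\mathcal F)$ onto this spectrum such that $\chi_\varphi([X]\otimes 1)=e^{\varphi(X)}$ for all $\varphi\in S_E(\mathcal F)$ and $X\in\mathcal F$. -/

import Mathlib

open scoped NNReal TensorProduct

universe u

/-- A commutative perfect semifield of characteristic one `(F, ⊕, +)`; the multiplicative law is
written additively and the element `-∞` is left out. -/
class PerfectSemifield (F : Type u) extends AddCommGroup F where
  oplus : F → F → F
  oplus_comm : ∀ X Y, oplus X Y = oplus Y X
  oplus_assoc : ∀ X Y Z, oplus (oplus X Y) Z = oplus X (oplus Y Z)
  oplus_self : ∀ X, oplus X X = X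
  add_oplus : ∀ X Y Z : F, X + oplus Y Z = oplus (X + Y) (X + Z)
  nsmul_surjective : ∀ n : ℕ, 0 < n → Function.Surjective (fun X : F => n • X)

namespace PerfectSemifield

variable {F : Type u} [PerfectSemifield F]

/-- The canonical order: `X ≤ Y` iff `X ⊕ Y = Y`. -/
instance instPartialOrder : PartialOrder F where
  le X Y := oplus X Y = Y
  le_refl X := oplus_self X
  le_trans X Y Z h₁ h₂ := by
    have h₁' : oplus X Y = Y := h₁
    have h₂' : oplus Y Z = Z := h₂
    rw [← h₂', ← oplus_assoc, h₁']
  le_antisymm X Y h₁ h₂ := by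
    have h₁' : oplus X Y = Y := h₁
    have h₂' : oplus Y X = X := h₂
    rw [← h₂', oplus_comm, h₁']

theorem le_def (X Y : F) : X ≤ Y ↔ oplus X Y = Y := Iff.rfl

theorem add_le_add_left' (X Y Z : F) (h : X ≤ Y) : Z + X ≤ Z + Y := by
  rw [le_def] at *
  rw [← add_oplus, h]

instance instAddLeftMono : AddLeftMono F := ⟨fun Z X Y h => add_le_add_left' X Y Z h⟩

instance instIsOrderedAddMonoid : IsOrderedAddMonoid F where
  add_le_add_left X Y h Z := by
    rw [add_comm X, add_comm Y]; exact add_le_add_left' X Y Z h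

/-- The law `⊕` is the supremum, and `-((-X) ⊕ (-Y))` the infimum, of the canonical order. -/
instance instLattice : Lattice F where
  __ := instPartialOrder
  sup := oplus
  le_sup_left X Y := by rw [le_def, ← oplus_assoc, oplus_self]
  le_sup_right X Y := by rw [le_def, oplus_comm X Y, ← oplus_assoc, oplus_self]
  sup_le X Y Z h₁ h₂ := by
    rw [le_def] at *
    rw [oplus_assoc, h₂, h₁]
  inf X Y := -oplus (-X) (-Y)
  inf_le_left X Y := by
    rw [neg_le, le_def, ← oplus_assoc, oplus_self]
  inf_le_right X Y := by
    rw [neg_le, le_def, oplus_comm (-X) (-Y), ← oplus_assoc, oplus_self]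
  le_inf X Y Z h₁ h₂ := by
    rw [le_neg]
    rw [← neg_le_neg_iff, le_def] at h₁ h₂
    rw [le_def, oplus_assoc, h₂, h₁]

theorem nonneg_of_nsmul_nonneg {n : ℕ} (hn : 0 < n) {X : F} (h : 0 ≤ n • X) : 0 ≤ X := by
  have hne : (Finset.range n).Nonempty := ⟨0, by simpa using hn⟩
  set s := (Finset.range n).sup' hne (fun k => k • X) with hs
  have key : s ≤ X + s := by
    apply Finset.sup'_le
    intro k hk
    rcases k with _ | k
    · have h1 : (n - 1) • X ≤ s :=
        Finset.le_sup' (fun k => k • X) (Finset.mem_range.2 (by omega))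
      have h2 : X + (n - 1) • X = n • X := by
        rw [add_comm, ← succ_nsmul]; congr 1; omega
      calc (0 : ℕ) • X = 0 := zero_nsmul X
        _ ≤ n • X := h
        _ = X + (n - 1) • X := h2.symm
        _ ≤ X + s := by gcongr
    · have h1 : k • X ≤ s :=
        Finset.le_sup' (fun k => k • X) (Finset.mem_range.2 (by
          have := Finset.mem_range.1 hk; omega))
      rw [succ_nsmul, add_comm]
      gcongr
  simpa using key

theorem le_of_nsmul_le_nsmul {n : ℕ} (hn : 0 < n) {X Y : F} (h : n • X ≤ n • Y) : X ≤ Y := by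
  rw [← sub_nonneg]
  apply nonneg_of_nsmul_nonneg hn
  rw [nsmul_sub]
  exact sub_nonneg.2 h

theorem nsmul_injective {n : ℕ} (hn : 0 < n) : Function.Injective (fun X : F => n • X) :=
  fun _ _ h => le_antisymm (le_of_nsmul_le_nsmul hn h.le) (le_of_nsmul_le_nsmul hn h.ge)

/-- The inverse of the bijection `X ↦ n X`. -/
noncomputable def divNat (n : ℕ) (X : F) : F := Function.invFun (fun Y : F => n • Y) X

theorem nsmul_divNat {n : ℕ} (hn : 0 < n) (X : F) : n • divNat n X = X :=
  Function.invFun_eq (nsmul_surjective n hn X)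

noncomputable instance instSMulRat : SMul ℚ F := ⟨fun q X => q.num • divNat q.den X⟩

theorem rat_smul_def (q : ℚ) (X : F) : q • X = q.num • divNat q.den X := rfl

theorem den_nsmul_rat_smul (q : ℚ) (X : F) : q.den • (q • X) = q.num • X := by
  rw [rat_smul_def, smul_comm, nsmul_divNat q.den_pos]

theorem nsmul_rat_smul {n : ℕ} {a : ℤ} {q : ℚ} (h : (n : ℚ) * q = a) (X : F) :
    n • (q • X) = a • X := by
  apply nsmul_injective q.den_pos
  change q.den • n • (q • X) = q.den • a • X
  rw [smul_comm, den_nsmul_rat_smul, ← natCast_zsmul, ← natCast_zsmul, ← mul_smul, ← mul_smul]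
  congr 1
  have h2 : (q.den : ℚ) * q = q.num := Rat.den_mul_eq_num q
  have : ((n * q.num : ℤ) : ℚ) = ((q.den * a : ℤ) : ℚ) := by
    push_cast
    rw [← h, ← h2]; ring
  exact_mod_cast this

theorem exists_int (q : ℚ) (n : ℕ) (h : q.den ∣ n) : ∃ a : ℤ, (n : ℚ) * q = a := by
  obtain ⟨k, rfl⟩ := h
  refine ⟨k * q.num, ?_⟩
  push_cast
  rw [← Rat.den_mul_eq_num q]; ring

/-- The canonical structure of `ℚ`-vector space. -/
noncomputable instance instModuleRat : Module ℚ F where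
  one_smul X := by simpa using nsmul_rat_smul (n := 1) (a := 1) (q := 1) (by simp) X
  mul_smul p q X := by
    have hn : 0 < p.den * q.den := by have := p.den_pos; have := q.den_pos; positivity
    apply nsmul_injective hn
    change (p.den * q.den) • ((p * q) • X) = (p.den * q.den) • (p • q • X)
    have h1 : ((p.den * q.den : ℕ) : ℚ) * (p * q) = ((p.num * q.num : ℤ) : ℚ) := by
      push_cast
      rw [← Rat.den_mul_eq_num p, ← Rat.den_mul_eq_num q]; ring
    rw [nsmul_rat_smul h1, mul_comm p.den, mul_smul q.den p.den, den_nsmul_rat_smul, smul_comm q.den,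
      den_nsmul_rat_smul, mul_smul]
  smul_zero q := by
    apply nsmul_injective q.den_pos
    change q.den • (q • (0 : F)) = q.den • 0
    rw [den_nsmul_rat_smul, smul_zero, smul_zero]
  smul_add q X Y := by
    apply nsmul_injective q.den_pos
    change q.den • (q • (X + Y)) = q.den • (q • X + q • Y)
    rw [nsmul_add, den_nsmul_rat_smul, den_nsmul_rat_smul, den_nsmul_rat_smul, zsmul_add]
  add_smul p q X := by
    have hn : 0 < p.den * q.den := by have := p.den_pos; have := q.den_pos; positivity
    apply nsmul_injective hn
    change (p.den * q.den) • ((p + q) • X) = (p.den * q.den) • (p • X + q • X)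
    obtain ⟨a, ha⟩ := exists_int p (p.den * q.den) (Dvd.intro _ rfl)
    obtain ⟨b, hb⟩ := exists_int q (p.den * q.den) (Dvd.intro_left _ rfl)
    have h1 : ((p.den * q.den : ℕ) : ℚ) * (p + q) = ((a + b : ℤ) : ℚ) := by
      rw [mul_add, ha, hb]; push_cast; ring
    rw [nsmul_rat_smul h1, nsmul_add, nsmul_rat_smul ha, nsmul_rat_smul hb, add_smul]
  zero_smul X := by simpa using nsmul_rat_smul (n := 1) (a := 0) (q := 0) (by simp) X

/-- `r(X)`: the infimum of the rationals `t ≥ 0` with `-tE ≤ X ≤ tE`. -/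
noncomputable def radius (E X : F) : ℝ :=
  sInf {s : ℝ | ∃ t : ℚ, 0 ≤ t ∧ -(t • E) ≤ X ∧ X ≤ t • E ∧ s = t}

theorem rat_smul_nonneg {q : ℚ} (hq : 0 ≤ q) {X : F} (hX : 0 ≤ X) : 0 ≤ q • X := by
  apply nonneg_of_nsmul_nonneg q.den_pos
  rw [den_nsmul_rat_smul]
  exact zsmul_nonneg hX (Rat.num_nonneg.2 hq)

theorem rat_smul_le_smul_left {q : ℚ} (hq : 0 ≤ q) {X Y : F} (h : X ≤ Y) : q • X ≤ q • Y := by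
  have := rat_smul_nonneg hq (sub_nonneg.2 h)
  rwa [smul_sub, sub_nonneg] at this

theorem rat_smul_le_smul_right {p q : ℚ} (h : p ≤ q) {X : F} (hX : 0 ≤ X) : p • X ≤ q • X := by
  have := rat_smul_nonneg (sub_nonneg.2 h) hX
  rwa [sub_smul, sub_nonneg] at this

end PerfectSemifield

open PerfectSemifield

/-- A commutative perfect Banach semifield of characteristic one `(F, ⊕, +)`, not reduced to `0`,
together with its absorbing element `E`. -/
class BanachSemifield (F : Type u) extends PerfectSemifield F, Nontrivial F where
  E : F
  absorbing : ∀ X : F, ∃ t : ℚ, 0 ≤ t ∧ -(t • E) ≤ X ∧ X ≤ t • E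
  radius_eq_zero_iff : ∀ X : F, radius E X = 0 ↔ X = 0
  complete : ∀ u : ℕ → F,
    (∀ ε : ℝ, 0 < ε → ∃ N, ∀ m ≥ N, ∀ n ≥ N, radius E (u m - u n) < ε) →
    ∃ L : F, ∀ ε : ℝ, 0 < ε → ∃ N, ∀ n ≥ N, radius E (u n - L) < ε

namespace BanachSemifield

variable {F : Type u} [BanachSemifield F]

theorem E_nonneg : (0 : F) ≤ E := by
  obtain ⟨t, ht, -, h⟩ := absorbing |(E : F)|
  rcases ht.eq_or_lt with rfl | ht
  · rw [zero_smul] at h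
    have h1 := (neg_le_abs (E : F)).trans h
    simpa using h1
  · have h1 := rat_smul_nonneg (inv_nonneg.2 ht.le) ((abs_nonneg _).trans h)
    rwa [smul_smul, inv_mul_cancel₀ ht.ne', one_smul] at h1

theorem radius_set_bddBelow (X : F) :
    BddBelow {s : ℝ | ∃ t : ℚ, 0 ≤ t ∧ -(t • (E : F)) ≤ X ∧ X ≤ t • E ∧ s = t} :=
  ⟨0, by rintro s ⟨t, ht, -, -, rfl⟩; exact_mod_cast ht⟩

theorem radius_nonneg (X : F) : 0 ≤ radius E X :=
  Real.sInf_nonneg (by rintro s ⟨t, ht, -, -, rfl⟩; exact_mod_cast ht)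

theorem radius_le {X : F} {t : ℚ} (ht : 0 ≤ t) (h₁ : -(t • E) ≤ X) (h₂ : X ≤ t • E) :
    radius E X ≤ t :=
  csInf_le (radius_set_bddBelow X) ⟨t, ht, h₁, h₂, rfl⟩

theorem of_radius_lt {X : F} {t : ℚ} (h : radius E X < t) :
    0 ≤ t ∧ -(t • E) ≤ X ∧ X ≤ t • E := by
  obtain ⟨t₀, ht₀⟩ := absorbing X
  obtain ⟨s, ⟨q, hq, h₁, h₂, rfl⟩, hs⟩ :=
    exists_lt_of_csInf_lt (s := {s : ℝ | ∃ t : ℚ, 0 ≤ t ∧ -(t • (E : F)) ≤ X ∧ X ≤ t • E ∧ s = t})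
      ⟨_, t₀, ht₀.1, ht₀.2.1, ht₀.2.2, rfl⟩ h
  have hqt : q ≤ t := by exact_mod_cast hs.le
  have hE := rat_smul_le_smul_right hqt (E_nonneg (F := F))
  exact ⟨hq.trans hqt, (neg_le_neg hE).trans h₁, h₂.trans hE⟩

theorem radius_neg (X : F) : radius E (-X) = radius E X := by
  have key : ∀ X : F, radius E (-X) ≤ radius E X := by
    intro X
    refine le_of_forall_gt_imp_ge_of_dense fun a ha => ?_
    obtain ⟨q, h₁, h₂⟩ := exists_rat_btwn ha
    obtain ⟨h0, h3, h4⟩ := of_radius_lt h₁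
    exact (radius_le h0 (neg_le_neg h4) (neg_le.1 h3)).trans h₂.le
  exact le_antisymm (key X) (by simpa using key (-X))

theorem radius_add (X Y : F) : radius E (X + Y) ≤ radius E X + radius E Y := by
  refine le_of_forall_pos_le_add fun ε hε => ?_
  obtain ⟨p, hp, hp'⟩ := exists_rat_btwn (show radius E X < radius E X + ε / 2 by linarith)
  obtain ⟨q, hq, hq'⟩ := exists_rat_btwn (show radius E Y < radius E Y + ε / 2 by linarith)
  obtain ⟨p0, p1, p2⟩ := of_radius_lt hp
  obtain ⟨q0, q1, q2⟩ := of_radius_lt hq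
  have := radius_le (X := X + Y) (add_nonneg p0 q0)
    (by rw [add_smul, neg_add]; exact add_le_add p1 q1)
    (by rw [add_smul]; exact add_le_add p2 q2)
  push_cast at this
  linarith

/-- The norm `r`; its distance is `r(X - Y)`. -/
noncomputable instance instNormedAddCommGroup : NormedAddCommGroup F :=
  AddGroupNorm.toNormedAddCommGroup
    { toFun := radius E
      map_zero' := (radius_eq_zero_iff 0).2 rfl
      add_le' := radius_add
      neg' := radius_neg
      eq_zero_of_map_eq_zero' := fun X h => (radius_eq_zero_iff X).1 h }

theorem norm_def (X : F) : ‖X‖ = radius E X := rfl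

instance instCompleteSpace : CompleteSpace F := by
  apply Metric.complete_of_cauchySeq_tendsto
  intro v hv
  rw [Metric.cauchySeq_iff] at hv
  obtain ⟨L, hL⟩ := complete v (fun ε hε => by
    obtain ⟨N, hN⟩ := hv ε hε
    exact ⟨N, fun m hm n hn => by have := hN m hm n hn; rwa [dist_eq_norm] at this⟩)
  refine ⟨L, Metric.tendsto_atTop.2 fun ε hε => ?_⟩
  obtain ⟨N, hN⟩ := hL ε hε
  exact ⟨N, fun n hn => by rw [dist_eq_norm]; exact hN n hn⟩

theorem norm_rat_smul_le (q : ℚ) (X : F) : ‖q • X‖ ≤ |(q : ℝ)| * ‖X‖ := by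
  have key : ∀ q : ℚ, 0 ≤ q → ‖q • X‖ ≤ q * ‖X‖ := by
    intro q hq
    have hq' : (0 : ℝ) ≤ q := by exact_mod_cast hq
    refine le_of_forall_pos_le_add fun ε hε => ?_
    have hd : 0 < ε / (q + 1) := by positivity
    obtain ⟨t, h₁, h₂⟩ := exists_rat_btwn (show radius E X < radius E X + ε / (q + 1) by linarith)
    obtain ⟨t0, t1, t2⟩ := of_radius_lt h₁
    have h3 := radius_le (X := q • X) (mul_nonneg hq t0)
      (by have := rat_smul_le_smul_left hq t1; rwa [smul_neg, smul_smul] at this)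
      (by have := rat_smul_le_smul_left hq t2; rwa [smul_smul] at this)
    push_cast at h3
    rw [norm_def, norm_def]
    have h4 : (q : ℝ) * t ≤ q * (radius E X + ε / (q + 1)) := by gcongr
    have h5 : (q : ℝ) * (ε / (q + 1)) ≤ ε := by
      rw [mul_div_assoc', div_le_iff₀ (by positivity)]; nlinarith
    nlinarith
  rcases le_total 0 q with hq | hq
  · rw [abs_of_nonneg (by exact_mod_cast hq)]; exact key q hq
  · have h := key (-q) (by linarith)
    rw [neg_smul, norm_neg] at h
    rw [abs_of_nonpos (by exact_mod_cast hq)]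
    push_cast at h; exact h

theorem uniformContinuous_rat_smul (X : F) : UniformContinuous (fun q : ℚ => q • X) := by
  have : LipschitzWith ‖X‖₊ (fun q : ℚ => q • X) := by
    apply LipschitzWith.of_dist_le_mul
    intro p q
    rw [dist_eq_norm, ← sub_smul, mul_comm]
    have := norm_rat_smul_le (p - q) X
    simpa [Rat.dist_eq] using this
  exact this.uniformContinuous

/-- The real multiple `t X`: the limit of `q X` as the rational `q` tends to `t`. -/
noncomputable instance instSMulReal : SMul ℝ F :=
  ⟨fun t X => Rat.isDenseEmbedding_coe_real.isDenseInducing.extend (fun q : ℚ => q • X) t⟩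

theorem real_smul_def (t : ℝ) (X : F) :
    t • X = Rat.isDenseEmbedding_coe_real.isDenseInducing.extend (fun q : ℚ => q • X) t := rfl

theorem continuous_real_smul (X : F) : Continuous (fun t : ℝ => t • X) :=
  (uniformContinuous_uniformly_extend Rat.isUniformEmbedding_coe_real.isUniformInducing
    Rat.isDenseEmbedding_coe_real.dense (uniformContinuous_rat_smul X)).continuous

theorem rat_cast_smul (q : ℚ) (X : F) : (q : ℝ) • X = q • X :=
  uniformly_extend_of_ind Rat.isUniformEmbedding_coe_real.isUniformInducing
    Rat.isDenseEmbedding_coe_real.dense (uniformContinuous_rat_smul X) q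

theorem real_smul_add (t : ℝ) (X Y : F) : t • (X + Y) = t • X + t • Y := by
  refine Rat.isDenseEmbedding_coe_real.dense.induction_on (p := fun t : ℝ =>
    t • (X + Y) = t • X + t • Y) t (isClosed_eq (continuous_real_smul _)
    ((continuous_real_smul X).add (continuous_real_smul Y))) (fun q => ?_)
  simp only [rat_cast_smul, smul_add]

theorem norm_real_smul_le (t : ℝ) (X : F) : ‖t • X‖ ≤ |t| * ‖X‖ := by
  refine Rat.isDenseEmbedding_coe_real.dense.induction_on (p := fun t : ℝ =>
    ‖t • X‖ ≤ |t| * ‖X‖) t (isClosed_le (continuous_real_smul X).norm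
    (by fun_prop)) (fun q => ?_)
  rw [rat_cast_smul]; exact norm_rat_smul_le q X

theorem continuous_real_smul_right (t : ℝ) : Continuous (fun X : F => t • X) := by
  let f : F →+ F := AddMonoidHom.mk' (fun X => t • X) (real_smul_add t)
  exact AddMonoidHomClass.continuous_of_bound f |t| (norm_real_smul_le t)

/-- The canonical structure of real vector space. -/
noncomputable instance instModuleReal : Module ℝ F where
  one_smul X := by
    have := rat_cast_smul 1 X
    rwa [Rat.cast_one, one_smul] at this
  zero_smul X := by
    have := rat_cast_smul 0 X
    rwa [Rat.cast_zero, zero_smul] at this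
  smul_zero t := by
    have := real_smul_add t (0 : F) 0
    rw [add_zero] at this
    simpa using this
  smul_add := real_smul_add
  add_smul s t X := by
    refine Rat.isDenseEmbedding_coe_real.dense.induction_on₂ (p := fun s t : ℝ =>
      (s + t) • X = s • X + t • X) ?_ ?_ s t
    · exact isClosed_eq ((continuous_real_smul X).comp (continuous_fst.add continuous_snd))
        (((continuous_real_smul X).comp continuous_fst).add
          ((continuous_real_smul X).comp continuous_snd))
    · intro p q
      rw [← Rat.cast_add, rat_cast_smul, rat_cast_smul, rat_cast_smul, add_smul]
  mul_smul s t X := by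
    refine Rat.isDenseEmbedding_coe_real.dense.induction_on (p := fun s : ℝ =>
      (s * t) • X = s • t • X) s (isClosed_eq ((continuous_real_smul X).comp (by fun_prop))
      (continuous_real_smul _)) (fun p => ?_)
    refine Rat.isDenseEmbedding_coe_real.dense.induction_on (p := fun t : ℝ =>
      ((p : ℝ) * t) • X = (p : ℝ) • t • X) t (isClosed_eq
      ((continuous_real_smul X).comp (by fun_prop))
      ((continuous_real_smul_right _).comp (continuous_real_smul X))) (fun q => ?_)
    rw [← Rat.cast_mul, rat_cast_smul, rat_cast_smul, rat_cast_smul, mul_smul]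


theorem norm_le_of_abs_le_rat {X : F} {q : ℚ} (hq : 0 ≤ q) (h : |X| ≤ q • E) : ‖X‖ ≤ q :=
  radius_le hq (neg_le.1 ((neg_le_abs X).trans h)) ((le_abs_self X).trans h)

theorem abs_le_rat_smul {X : F} {q : ℚ} (h : ‖X‖ < q) : |X| ≤ q • E := by
  obtain ⟨-, h1, h2⟩ := of_radius_lt h
  exact abs_le'.2 ⟨h2, neg_le.1 h1⟩

instance instHasSolidNorm : HasSolidNorm F where
  solid X Y h := by
    refine le_of_forall_gt_imp_ge_of_dense fun a ha => ?_
    obtain ⟨q, h₁, h₂⟩ := exists_rat_btwn ha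
    have hq : (0 : ℝ) ≤ q := (norm_nonneg Y).trans h₁.le
    exact (norm_le_of_abs_le_rat (by exact_mod_cast hq) (h.trans (abs_le_rat_smul h₁))).trans h₂.le

theorem real_smul_nonneg {t : ℝ} (ht : 0 ≤ t) {X : F} (hX : 0 ≤ X) : 0 ≤ t • X := by
  obtain ⟨v, -, hv, hv'⟩ := Real.exists_seq_rat_strictAnti_tendsto t
  refine ge_of_tendsto' (((continuous_real_smul X).tendsto t).comp hv') fun n => ?_
  change 0 ≤ ((v n : ℚ) : ℝ) • X
  rw [rat_cast_smul]
  exact rat_smul_nonneg (by exact_mod_cast (ht.trans (hv n).le)) hX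

theorem real_smul_le_smul_left {t : ℝ} (ht : 0 ≤ t) {X Y : F} (h : X ≤ Y) : t • X ≤ t • Y := by
  have := real_smul_nonneg ht (sub_nonneg.2 h)
  rwa [smul_sub, sub_nonneg] at this

theorem real_smul_le_smul_right {s t : ℝ} (h : s ≤ t) {X : F} (hX : 0 ≤ X) : s • X ≤ t • X := by
  have := real_smul_nonneg (sub_nonneg.2 h) hX
  rwa [sub_smul, sub_nonneg] at this

theorem abs_le_norm_smul (X : F) : |X| ≤ ‖X‖ • (E : F) := by
  obtain ⟨v, -, hv, hv'⟩ := Real.exists_seq_rat_strictAnti_tendsto ‖X‖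
  refine ge_of_tendsto' (((continuous_real_smul (E : F)).tendsto ‖X‖).comp hv') fun n => ?_
  change |X| ≤ ((v n : ℚ) : ℝ) • (E : F)
  rw [rat_cast_smul]
  exact abs_le_rat_smul (hv n)

theorem norm_le_of_abs_le {X : F} {t : ℝ} (ht : 0 ≤ t) (h : |X| ≤ t • E) : ‖X‖ ≤ t := by
  refine le_of_forall_gt_imp_ge_of_dense fun a ha => ?_
  obtain ⟨q, h₁, h₂⟩ := exists_rat_btwn ha
  refine (norm_le_of_abs_le_rat (by exact_mod_cast ht.trans h₁.le) (h.trans ?_)).trans h₂.le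
  rw [← rat_cast_smul]
  exact real_smul_le_smul_right h₁.le E_nonneg

theorem exists_isLUB_of_isCompact {K : Set F} (hK : IsCompact K) (hne : K.Nonempty) :
    ∃ S, IsLUB K S := by
  have h1 : ∀ n : ℕ, ∃ S : F, S ∈ lowerBounds (upperBounds K) ∧
      ∀ X ∈ K, X ≤ S + (1 / ((n : ℝ) + 1)) • E := by
    intro n
    obtain ⟨t, htK, htf, hcov⟩ := hK.finite_cover_balls (e := 1 / ((n : ℝ) + 1)) (by positivity)
    have htne : t.Nonempty := by
      obtain ⟨x, hx⟩ := hne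
      obtain ⟨y, hy, -⟩ := Set.mem_iUnion₂.1 (hcov hx)
      exact ⟨y, hy⟩
    have hne' : htf.toFinset.Nonempty := by simpa using htne
    refine ⟨htf.toFinset.sup' hne' id, ?_, ?_⟩
    · intro U hU
      exact Finset.sup'_le _ _ fun b hb => hU (htK (by simpa using hb))
    · intro X hX
      obtain ⟨y, hy, hXy⟩ := Set.mem_iUnion₂.1 (hcov hX)
      have h2 : X - y ≤ (1 / ((n : ℝ) + 1)) • E := by
        refine ((le_abs_self _).trans (abs_le_norm_smul _)).trans
          (real_smul_le_smul_right ?_ E_nonneg)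
        rw [← dist_eq_norm]; exact (Metric.mem_ball.1 hXy).le
      have h3 : y ≤ htf.toFinset.sup' hne' id :=
        Finset.le_sup' id (by simpa using hy)
      calc X ≤ y + (1 / ((n : ℝ) + 1)) • E := by rwa [← sub_le_iff_le_add']
        _ ≤ _ := by gcongr
  choose s hs hs' using h1
  have h2 : ∀ m n, s m - s n ≤ (1 / ((n : ℝ) + 1)) • E := by
    intro m n
    rw [sub_le_iff_le_add']
    exact hs m fun X hX => hs' n X hX
  have hmono : ∀ {n N : ℕ}, N ≤ n → (1 / ((n : ℝ) + 1)) • (E : F) ≤ (1 / ((N : ℝ) + 1)) • E :=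
    fun h => real_smul_le_smul_right (one_div_le_one_div_of_le (by positivity)
      (by exact_mod_cast Nat.succ_le_succ h)) E_nonneg
  have hc : CauchySeq s := by
    refine cauchySeq_of_le_tendsto_0 (fun n : ℕ => 1 / ((n : ℝ) + 1)) (fun n m N hn hm => ?_)
      tendsto_one_div_add_atTop_nhds_zero_nat
    rw [dist_eq_norm]
    refine norm_le_of_abs_le (by positivity) (abs_le'.2 ⟨(h2 n m).trans (hmono hm), ?_⟩)
    rw [neg_sub]
    exact (h2 m n).trans (hmono hn)
  obtain ⟨S, hS⟩ := cauchySeq_tendsto_of_complete hc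
  refine ⟨S, fun X hX => ?_, fun U hU => le_of_tendsto' hS fun n => hs n hU⟩
  have h3 : Filter.Tendsto (fun n : ℕ => s n + (1 / ((n : ℝ) + 1)) • (E : F)) Filter.atTop
      (nhds (S + (0 : ℝ) • E)) :=
    hS.add (((continuous_real_smul (E : F)).tendsto 0).comp
      tendsto_one_div_add_atTop_nhds_zero_nat)
  rw [zero_smul, add_zero] at h3
  exact ge_of_tendsto' h3 fun n => hs' n X hX

/-- The term `w(α) x^α y^(1-α)` with `w(α) = ρ^(S(α))`, `S` the entropy, `ρ = E`, written
additively. -/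
noncomputable def mix (X Y : F) (α : ℝ) : F := Real.binEntropy α • E + α • X + (1 - α) • Y

theorem exists_isLUB_mix (X Y : F) : ∃ S, IsLUB (mix X Y '' Set.Icc 0 1) S := by
  apply exists_isLUB_of_isCompact
  · apply isCompact_Icc.image
    exact (((continuous_real_smul _).comp Real.binEntropy_continuous).add
      (continuous_real_smul X)).add ((continuous_real_smul Y).comp (by fun_prop))
  · exact Set.Nonempty.image _ ⟨0, by simp⟩

/-- The Witt addition: the sum in the sense of `⊕` of all `S(α) E + α X + (1 - α) Y`,
`0 ≤ α ≤ 1`, i.e. their least upper bound. -/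
noncomputable def wadd (X Y : F) : F := (exists_isLUB_mix X Y).choose

theorem isLUB_wadd (X Y : F) : IsLUB (mix X Y '' Set.Icc 0 1) (wadd X Y) :=
  (exists_isLUB_mix X Y).choose_spec

theorem mix_le_wadd (X Y : F) {α : ℝ} (h : α ∈ Set.Icc (0 : ℝ) 1) : mix X Y α ≤ wadd X Y :=
  (isLUB_wadd X Y).1 ⟨α, h, rfl⟩

theorem wadd_le_iff {X Y Z : F} : wadd X Y ≤ Z ↔ ∀ α ∈ Set.Icc (0 : ℝ) 1, mix X Y α ≤ Z := by
  rw [isLUB_le_iff (isLUB_wadd X Y)]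
  exact ⟨fun h α hα => h ⟨α, hα, rfl⟩, fun h => by rintro _ ⟨α, hα, rfl⟩; exact h α hα⟩

theorem mix_symm (X Y : F) (α : ℝ) : mix Y X (1 - α) = mix X Y α := by
  simp only [mix, Real.binEntropy_one_sub, sub_sub_cancel]
  abel

theorem wadd_comm (X Y : F) : wadd X Y = wadd Y X := by
  have key : ∀ X Y : F, wadd X Y ≤ wadd Y X := by
    intro X Y
    rw [wadd_le_iff]
    intro α hα
    rw [← mix_symm]
    exact mix_le_wadd _ _ ⟨by linarith [hα.2], by linarith [hα.1]⟩
  exact le_antisymm (key X Y) (key Y X)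

theorem add_wadd (X Y Z : F) : X + wadd Y Z = wadd (X + Y) (X + Z) := by
  have hm : ∀ (X Y Z : F) (α : ℝ), mix (X + Y) (X + Z) α = X + mix Y Z α := by
    intro X Y Z α
    simp only [mix]
    module
  apply le_antisymm
  · rw [← le_sub_iff_add_le', wadd_le_iff]
    intro α hα
    rw [le_sub_iff_add_le', ← hm]
    exact mix_le_wadd _ _ hα
  · rw [wadd_le_iff]
    intro α hα
    rw [hm]
    gcongr
    exact mix_le_wadd _ _ hα

theorem wadd_mono {X X' Y Y' : F} (hX : X ≤ X') (hY : Y ≤ Y') : wadd X Y ≤ wadd X' Y' := by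
  rw [wadd_le_iff]
  intro α hα
  refine le_trans ?_ (mix_le_wadd X' Y' hα)
  exact add_le_add (add_le_add le_rfl (real_smul_le_smul_left hα.1 hX))
    (real_smul_le_smul_left (by linarith [hα.2]) hY)

/-- The three-term analogue of `mix`, with the entropy of a distribution on three points. -/
noncomputable def mix₃ (X Y Z : F) (a b c : ℝ) : F :=
  (Real.negMulLog a + Real.negMulLog b + Real.negMulLog c) • E + a • X + b • Y + c • Z

theorem mix_mix (X Y Z : F) (α β : ℝ) :
    Real.binEntropy α • E + α • mix X Y β + (1 - α) • Z =
      mix₃ X Y Z (α * β) (α * (1 - β)) (1 - α) := by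
  have h : Real.binEntropy α + α * Real.binEntropy β = Real.negMulLog (α * β) +
      Real.negMulLog (α * (1 - β)) + Real.negMulLog (1 - α) := by
    rw [Real.binEntropy_eq_negMulLog_add_negMulLog_one_sub,
      Real.binEntropy_eq_negMulLog_add_negMulLog_one_sub, Real.negMulLog_mul,
      Real.negMulLog_mul]
    ring
  simp only [mix, mix₃, ← h]
  module

theorem wadd_wadd_le_iff {X Y Z U : F} : wadd (wadd X Y) Z ≤ U ↔
    ∀ a b c : ℝ, 0 ≤ a → 0 ≤ b → 0 ≤ c → a + b + c = 1 → mix₃ X Y Z a b c ≤ U := by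
  constructor
  · intro h a b c ha hb hc habc
    refine le_trans ?_ h
    rcases (add_nonneg ha hb).eq_or_lt with h0 | h0
    · have ha0 : a = 0 := by linarith
      have hb0 : b = 0 := by linarith
      have hc1 : c = 1 := by linarith
      subst ha0 hb0 hc1
      have := mix_le_wadd (wadd X Y) Z (α := 0) (by simp)
      simpa [mix, mix₃] using this
    · have hβ : a / (a + b) ∈ Set.Icc (0 : ℝ) 1 :=
        ⟨by positivity, (div_le_one h0).2 (by linarith)⟩
      have h1 := mix_mix X Y Z (a + b) (a / (a + b))
      have e1 : (a + b) * (a / (a + b)) = a := by field_simp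
      have e2 : (a + b) * (1 - a / (a + b)) = b := by field_simp; ring
      have e3 : 1 - (a + b) = c := by linarith
      rw [e1, e2, e3] at h1
      rw [← h1]
      refine le_trans ?_ (mix_le_wadd (wadd X Y) Z (α := a + b) ⟨h0.le, by linarith⟩)
      rw [mix.eq_def (wadd X Y) Z, e3]
      gcongr
      exact real_smul_le_smul_left h0.le (mix_le_wadd X Y hβ)
  · intro h
    rw [wadd_le_iff]
    intro α hα
    rcases hα.1.eq_or_lt with h0 | h0
    · subst h0
      have := h 0 0 1 le_rfl le_rfl zero_le_one (by norm_num)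
      simpa [mix, mix₃] using this
    · have h2 : wadd X Y ≤ α⁻¹ • (U - Real.binEntropy α • E - (1 - α) • Z) := by
        rw [wadd_le_iff]
        intro β hβ
        have h3 := h (α * β) (α * (1 - β)) (1 - α) (mul_nonneg h0.le hβ.1)
          (mul_nonneg h0.le (by linarith [hβ.2])) (by linarith [hα.2]) (by ring)
        rw [← mix_mix] at h3
        have h4 : α • mix X Y β ≤ U - Real.binEntropy α • E - (1 - α) • Z := by
          rw [le_sub_iff_add_le, le_sub_iff_add_le]
          refine le_trans (le_of_eq ?_) h3
          abel
        have h5 := real_smul_le_smul_left (inv_nonneg.2 h0.le) h4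
        rwa [smul_smul, inv_mul_cancel₀ h0.ne', one_smul] at h5
      have h6 := real_smul_le_smul_left h0.le h2
      rw [smul_smul, mul_inv_cancel₀ h0.ne', one_smul, le_sub_iff_add_le,
        le_sub_iff_add_le] at h6
      refine le_trans (le_of_eq ?_) h6
      rw [mix]; abel

theorem mix₃_swap (X Y Z : F) (a b c : ℝ) : mix₃ Z Y X a b c = mix₃ X Y Z c b a := by
  have h : Real.negMulLog a + Real.negMulLog b + Real.negMulLog c =
      Real.negMulLog c + Real.negMulLog b + Real.negMulLog a := by ring
  simp only [mix₃, h]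
  abel

theorem wadd_assoc (X Y Z : F) : wadd (wadd X Y) Z = wadd X (wadd Y Z) := by
  have key : ∀ X Y Z : F, wadd (wadd Z Y) X ≤ wadd (wadd X Y) Z := by
    intro X Y Z
    have h := wadd_wadd_le_iff.1 (le_refl (wadd (wadd X Y) Z))
    refine wadd_wadd_le_iff.2 fun a b c ha hb hc habc => ?_
    rw [mix₃_swap]
    exact h c b a hc hb ha (by linarith)
  rw [wadd_comm X (wadd Y Z), wadd_comm Y Z]
  exact le_antisymm (key Z Y X) (key X Y Z)

theorem gibbs {s t α : ℝ} (hs : 0 < s) (ht : 0 < t) (hα : α ∈ Set.Icc (0 : ℝ) 1) :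
    Real.binEntropy α + α * Real.log s + (1 - α) * Real.log t ≤ Real.log (s + t) := by
  rcases hα.1.eq_or_lt with h0 | h0
  · subst h0
    simpa using Real.log_le_log ht (by linarith)
  rcases hα.2.eq_or_lt with h1 | h1
  · subst h1
    simpa using Real.log_le_log hs (by linarith)
  have h1' : 0 < 1 - α := by linarith
  have hc := strictConcaveOn_log_Ioi.concaveOn.2 (x := s / α) (y := t / (1 - α))
    (div_pos hs h0) (div_pos ht h1') h0.le h1'.le (by ring)
  have e : α • (s / α) + (1 - α) • (t / (1 - α)) = s + t := by
    simp only [smul_eq_mul]; field_simp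
  rw [e] at hc
  refine le_trans (le_of_eq ?_) hc
  rw [Real.log_div hs.ne' h0.ne', Real.log_div ht.ne' h1'.ne', Real.binEntropy, Real.log_inv,
    Real.log_inv]
  simp only [smul_eq_mul]; ring

theorem gibbs_eq {s t : ℝ} (hs : 0 < s) (ht : 0 < t) :
    Real.binEntropy (s / (s + t)) + s / (s + t) * Real.log s + (1 - s / (s + t)) * Real.log t =
      Real.log (s + t) := by
  have hst : 0 < s + t := by linarith
  have e : 1 - s / (s + t) = t / (s + t) := by field_simp; ring
  rw [Real.binEntropy, e, Real.log_inv, Real.log_inv, Real.log_div hs.ne' hst.ne',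
    Real.log_div ht.ne' hst.ne']
  field_simp; ring

theorem wadd_log_smul {s t : ℝ} (hs : 0 < s) (ht : 0 < t) :
    wadd (Real.log s • (E : F)) (Real.log t • E) = Real.log (s + t) • E := by
  have hm : ∀ α : ℝ, mix (Real.log s • (E : F)) (Real.log t • E) α =
      (Real.binEntropy α + α * Real.log s + (1 - α) * Real.log t) • E := by
    intro α; simp only [mix]; module
  apply le_antisymm
  · rw [wadd_le_iff]
    intro α hα
    rw [hm]
    exact real_smul_le_smul_right (gibbs hs ht hα) E_nonneg
  · rw [← gibbs_eq hs ht, ← hm]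
    exact mix_le_wadd _ _ ⟨by positivity, (div_le_one (by linarith)).2 (by linarith)⟩

end BanachSemifield

open BanachSemifield

/-- The semiring `(F ∪ {-∞}, wadd, +)`: its product is the law `+` of `F`, its zero is `-∞`,
its one is `0 : F`. -/
def WittSemiring (F : Type u) : Type u := WithZero (Multiplicative F)

namespace WittSemiring

variable {F : Type u} [BanachSemifield F]

instance instPartialOrder : PartialOrder (WittSemiring F) :=
  inferInstanceAs (PartialOrder (WithZero (Multiplicative F)))

instance instCommMonoidWithZero : CommMonoidWithZero (WittSemiring F) :=
  inferInstanceAs (CommMonoidWithZero (WithZero (Multiplicative F)))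

/-- The element of the Witt semiring given by `X : F`. -/
def of (X : F) : WittSemiring F := ((Multiplicative.ofAdd X : Multiplicative F) : WithZero _)

theorem ind {p : WittSemiring F → Prop} (zero : p 0) (coe : ∀ X : F, p (of X))
    (x : WittSemiring F) : p x := by
  rcases x with _ | X
  · exact zero
  · exact coe X

noncomputable instance instAdd : Add (WittSemiring F) where
  add x y := match x, y with
    | none, y => y
    | some X, none => some X
    | some X, some Y => of (wadd (Multiplicative.toAdd X) (Multiplicative.toAdd Y))

theorem zero_add' (x : WittSemiring F) : 0 + x = x := by
  rcases x with _ | X <;> rfl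

theorem add_zero' (x : WittSemiring F) : x + 0 = x := by
  rcases x with _ | X <;> rfl

theorem of_add_of (X Y : F) : of X + of Y = of (wadd X Y) := rfl

theorem of_mul_of (X Y : F) : of X * of Y = of (X + Y) := rfl

theorem one_eq : (1 : WittSemiring F) = of 0 := rfl

theorem of_le_of {X Y : F} : of X ≤ of Y ↔ X ≤ Y := WithZero.coe_le_coe

theorem zero_le' (x : WittSemiring F) : 0 ≤ x :=
  @_root_.zero_le (WithZero (Multiplicative F)) _ _ _ x

theorem add_comm' (x y : WittSemiring F) : x + y = y + x := by
  induction x using ind with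
  | zero => rw [zero_add', add_zero']
  | coe X =>
    induction y using ind with
    | zero => rw [zero_add', add_zero']
    | coe Y => rw [of_add_of, of_add_of, wadd_comm]

theorem left_distrib' (x y z : WittSemiring F) : x * (y + z) = x * y + x * z := by
  induction x using ind with
  | zero => simp only [zero_mul, zero_add']
  | coe X =>
    induction y using ind with
    | zero => simp only [mul_zero, zero_add']
    | coe Y =>
      induction z using ind with
      | zero => simp only [mul_zero, add_zero']
      | coe Z => simp only [of_add_of, of_mul_of, add_wadd]

noncomputable instance instCommSemiring : CommSemiring (WittSemiring F) where
  __ := instCommMonoidWithZero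
  add := (· + ·)
  nsmul := nsmulRec
  zero_add := zero_add'
  add_zero := add_zero'
  add_comm := add_comm'
  add_assoc x y z := by
    induction x using ind with
    | zero => simp only [zero_add']
    | coe X =>
      induction y using ind with
      | zero => simp only [zero_add', add_zero']
      | coe Y =>
        induction z using ind with
        | zero => simp only [add_zero']
        | coe Z => simp only [of_add_of, wadd_assoc]
  left_distrib := left_distrib'
  right_distrib x y z := by
    rw [mul_comm, left_distrib', mul_comm z x, mul_comm z y]

theorem add_mono {x x' y y' : WittSemiring F} (hx : x ≤ x') (hy : y ≤ y') :
    x + y ≤ x' + y' := by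
  have key : ∀ {a b c : WittSemiring F}, a ≤ b → a + c ≤ b + c := by
    intro a b c h
    induction c using ind with
    | zero => rwa [add_zero, add_zero]
    | coe C =>
      induction b using ind with
      | zero => rw [le_antisymm h (zero_le' _)]
      | coe B =>
        induction a using ind with
        | zero =>
          rw [zero_add, of_add_of, of_le_of]
          have := mix_le_wadd B C (α := 0) (by simp)
          simpa [mix] using this
        | coe A =>
          rw [of_add_of, of_add_of, of_le_of]
          exact wadd_mono (of_le_of.1 h) le_rfl
  calc x + y ≤ x' + y := key hx
    _ = y + x' := add_comm _ _
    _ ≤ y' + x' := key hy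
    _ = x' + y' := add_comm _ _

theorem mul_mono {x x' y y' : WittSemiring F} (hx : x ≤ x') (hy : y ≤ y') :
    x * y ≤ x' * y' := by
  have key : ∀ {a b c : WittSemiring F}, a ≤ b → a * c ≤ b * c := by
    intro a b c h
    induction c using ind with
    | zero => rw [mul_zero, mul_zero]
    | coe C =>
      induction b using ind with
      | zero => rw [le_antisymm h (zero_le' _)]
      | coe B =>
        induction a using ind with
        | zero => rw [zero_mul]; exact zero_le' _
        | coe A =>
          rw [of_mul_of, of_mul_of, of_le_of]
          exact add_le_add (of_le_of.1 h) le_rfl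
  calc x * y ≤ x' * y := key hx
    _ = y * x' := mul_comm _ _
    _ ≤ y' * x' := key hy
    _ = x' * y' := mul_comm _ _

/-- The nonnegative reals inside the Witt semiring: `s > 0` is `ρ^(log s)`, i.e. `(log s) E`. -/
noncomputable def const : ℝ≥0 →+* WittSemiring F where
  toFun s := if s = 0 then 0 else of (Real.log s • E)
  map_zero' := by simp
  map_one' := by simp [one_eq]
  map_add' s t := by
    rcases eq_or_ne s 0 with rfl | hs
    · simp
    rcases eq_or_ne t 0 with rfl | ht
    · simp
    have hst : s + t ≠ 0 := by positivity
    rw [if_neg hs, if_neg ht, if_neg hst, of_add_of, NNReal.coe_add,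
      wadd_log_smul (by positivity) (by positivity)]
  map_mul' s t := by
    rcases eq_or_ne s 0 with rfl | hs
    · simp
    rcases eq_or_ne t 0 with rfl | ht
    · simp
    rw [if_neg hs, if_neg ht, if_neg (mul_ne_zero hs ht), of_mul_of, NNReal.coe_mul,
      Real.log_mul (by simpa using hs) (by simpa using ht), add_smul]

theorem const_of_ne_zero {s : ℝ≥0} (hs : s ≠ 0) :
    (const s : WittSemiring F) = of (Real.log s • E) := if_neg hs

theorem exists_le_const (x : WittSemiring F) : ∃ s : ℝ≥0, x ≤ const s := by
  induction x using ind with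
  | zero => exact ⟨0, zero_le' _⟩
  | coe X =>
    refine ⟨(Real.exp ‖X‖).toNNReal, ?_⟩
    rw [const_of_ne_zero (by simpa using Real.exp_pos _), of_le_of,
      Real.coe_toNNReal _ (Real.exp_pos _).le, Real.log_exp]
    exact (le_abs_self X).trans (abs_le_norm_smul X)

/-- The size of `x`: the infimum of the reals `s ≥ 0` with `x ≤ s`. For `x = of X` this is
`exp (inf {t | X ≤ t E})`. -/
noncomputable def size (x : WittSemiring F) : ℝ := sInf {s : ℝ | ∃ t : ℝ≥0, x ≤ const t ∧ s = t}

theorem size_nonneg (x : WittSemiring F) : 0 ≤ size x :=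
  Real.sInf_nonneg (by rintro s ⟨t, -, rfl⟩; exact t.2)

theorem size_le {x : WittSemiring F} {t : ℝ≥0} (h : x ≤ const t) : size x ≤ t :=
  csInf_le ⟨0, by rintro s ⟨t, -, rfl⟩; exact t.2⟩ ⟨t, h, rfl⟩

theorem exists_of_size_lt {x : WittSemiring F} {s : ℝ} (h : size x < s) :
    ∃ t : ℝ≥0, x ≤ const t ∧ (t : ℝ) < s := by
  obtain ⟨t₀, ht₀⟩ := exists_le_const x
  obtain ⟨_, ⟨t, ht, rfl⟩, hs⟩ :=
    exists_lt_of_csInf_lt (s := {s : ℝ | ∃ t : ℝ≥0, x ≤ const t ∧ s = t}) ⟨_, t₀, ht₀, rfl⟩ h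
  exact ⟨t, ht, hs⟩

theorem size_zero : size (0 : WittSemiring F) = 0 :=
  le_antisymm (by simpa using size_le (x := (0 : WittSemiring F)) (t := 0) (zero_le' _))
    (size_nonneg _)

theorem size_add (x y : WittSemiring F) : size (x + y) ≤ size x + size y := by
  refine le_of_forall_pos_le_add fun ε hε => ?_
  obtain ⟨s, hs, hs'⟩ := exists_of_size_lt (show size x < size x + ε / 2 by linarith)
  obtain ⟨t, ht, ht'⟩ := exists_of_size_lt (show size y < size y + ε / 2 by linarith)
  have := size_le (x := x + y) (t := s + t) (by rw [map_add]; exact add_mono hs ht)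
  push_cast at this
  linarith

theorem size_mul (x y : WittSemiring F) : size (x * y) ≤ size x * size y := by
  refine le_of_forall_gt_imp_ge_of_dense fun a ha => ?_
  have hcont : Filter.Tendsto (fun δ : ℝ => (size x + δ) * (size y + δ)) (nhdsWithin 0 (Set.Ioi 0))
      (nhds ((size x + 0) * (size y + 0))) :=
    (Continuous.tendsto (by fun_prop) 0).mono_left nhdsWithin_le_nhds
  rw [add_zero, add_zero] at hcont
  obtain ⟨δ, hδa, hδ⟩ := ((hcont.eventually (gt_mem_nhds ha)).and self_mem_nhdsWithin).exists
  have hδ' : 0 < δ := hδ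
  obtain ⟨s, hs, hs'⟩ := exists_of_size_lt (show size x < size x + δ by linarith)
  obtain ⟨t, ht, ht'⟩ := exists_of_size_lt (show size y < size y + δ by linarith)
  have h := size_le (x := x * y) (t := s * t) (by rw [map_mul]; exact mul_mono hs ht)
  push_cast at h
  have h2 : (s : ℝ) * t ≤ (size x + δ) * (size y + δ) :=
    mul_le_mul hs'.le ht'.le t.2 (by linarith [size_nonneg x])
  linarith

end WittSemiring

/-- The Witt ring `W(F, E)`: the Grothendieck ring of the Witt semiring. -/
def WittRing (F : Type u) [BanachSemifield F] : Type u :=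
  Algebra.GrothendieckAddGroup (WittSemiring F)

namespace WittRing

variable {F : Type u} [BanachSemifield F]

noncomputable instance instAddCommGroup : AddCommGroup (WittRing F) :=
  inferInstanceAs (AddCommGroup (Algebra.GrothendieckAddGroup (WittSemiring F)))

/-- The canonical map from the Witt semiring to its Grothendieck ring. -/
noncomputable def ι : WittSemiring F →+ WittRing F := Algebra.GrothendieckAddGroup.of

theorem exists_sub (ξ : WittRing F) : ∃ x y : WittSemiring F, ξ = ι x - ι y := by
  obtain ⟨⟨x, y⟩, h⟩ := (AddLocalization.addMonoidOf (⊤ : AddSubmonoid (WittSemiring F))).surj ξ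
  exact ⟨x, y, eq_sub_of_add_eq h⟩

theorem hom_ext {G : Type*} [AddCommGroup G] {f g : WittRing F →+ G}
    (h : ∀ x, f (ι x) = g (ι x)) : f = g := by
  ext ξ
  obtain ⟨x, y, rfl⟩ := exists_sub ξ
  rw [map_sub, map_sub, h, h]

/-- The additive extension to the Grothendieck group. -/
noncomputable def lift {G : Type*} [AddCommGroup G] (f : WittSemiring F →+ G) : WittRing F →+ G :=
  Algebra.GrothendieckAddGroup.lift f

theorem lift_ι {G : Type*} [AddCommGroup G] (f : WittSemiring F →+ G) (x : WittSemiring F) :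
    lift f (ι x) = f x :=
  DFunLike.congr_fun (Algebra.GrothendieckAddGroup.lift.symm_apply_apply f) x

/-- The biadditive extension of the product of the Witt semiring. -/
noncomputable def mulHom : WittRing F →+ WittRing F →+ WittRing F :=
  lift
    { toFun := fun x => lift (ι.comp (AddMonoidHom.mulLeft x))
      map_zero' := hom_ext fun y => by simp [lift_ι]
      map_add' := fun x x' => hom_ext fun y => by simp [lift_ι, add_mul] }

theorem mulHom_ι (x y : WittSemiring F) : mulHom (ι x) (ι y) = ι (x * y) := by
  simp [mulHom, lift_ι]

noncomputable instance instMul : Mul (WittRing F) := ⟨fun ξ η => mulHom ξ η⟩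

theorem mul_def (ξ η : WittRing F) : ξ * η = mulHom ξ η := rfl

theorem mulHom_comm (ξ η : WittRing F) : mulHom ξ η = mulHom η ξ := by
  have : (mulHom : WittRing F →+ WittRing F →+ WittRing F) = mulHom.flip :=
    hom_ext fun x => hom_ext fun y => by
      rw [AddMonoidHom.flip_apply, mulHom_ι, mulHom_ι, mul_comm]
  exact DFunLike.congr_fun (DFunLike.congr_fun this ξ) η

noncomputable instance instCommRing : CommRing (WittRing F) where
  __ := instAddCommGroup
  mul := (· * ·)
  one := ι 1
  left_distrib a b c := map_add (mulHom a) b c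
  right_distrib a b c := by
    change mulHom (a + b) c = mulHom a c + mulHom b c
    rw [map_add, AddMonoidHom.add_apply]
  zero_mul a := by
    change mulHom 0 a = 0
    rw [map_zero, AddMonoidHom.zero_apply]
  mul_zero a := map_zero (mulHom a)
  mul_comm := mulHom_comm
  one_mul a := by
    change mulHom (ι 1) a = a
    have : mulHom (ι (1 : WittSemiring F)) = AddMonoidHom.id _ :=
      hom_ext fun x => by rw [mulHom_ι, one_mul, AddMonoidHom.id_apply]
    rw [this, AddMonoidHom.id_apply]
  mul_one a := by
    change mulHom a (ι 1) = a
    have : mulHom (ι (1 : WittSemiring F)) = AddMonoidHom.id _ :=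
      hom_ext fun x => by rw [mulHom_ι, one_mul, AddMonoidHom.id_apply]
    rw [mulHom_comm, this, AddMonoidHom.id_apply]
  mul_assoc a b c := by
    change mulHom (mulHom a b) c = mulHom a (mulHom b c)
    obtain ⟨x, x', rfl⟩ := exists_sub a
    obtain ⟨y, y', rfl⟩ := exists_sub b
    obtain ⟨z, z', rfl⟩ := exists_sub c
    simp only [map_sub, AddMonoidHom.sub_apply, mulHom_ι, mul_assoc]

theorem ι_mul (x y : WittSemiring F) : ι (x * y) = ι x * ι y := (mulHom_ι x y).symm

theorem ι_one : ι (1 : WittSemiring F) = 1 := rfl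

/-- The norm on `W(F, E)`: the infimum of `size x + size y` over all writings `ξ = x - y`. -/
noncomputable def wittNorm (ξ : WittRing F) : ℝ :=
  sInf {s : ℝ | ∃ x y : WittSemiring F, ξ = ι x - ι y ∧ s = x.size + y.size}

theorem wittNorm_nonneg (ξ : WittRing F) : 0 ≤ wittNorm ξ :=
  Real.sInf_nonneg (by
    rintro s ⟨x, y, -, rfl⟩
    exact add_nonneg x.size_nonneg y.size_nonneg)

theorem wittNorm_le (x y : WittSemiring F) : wittNorm (ι x - ι y) ≤ x.size + y.size :=
  csInf_le ⟨0, by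
    rintro s ⟨x, y, -, rfl⟩
    exact add_nonneg x.size_nonneg y.size_nonneg⟩ ⟨x, y, rfl, rfl⟩

theorem exists_of_wittNorm_lt {ξ : WittRing F} {s : ℝ} (h : wittNorm ξ < s) :
    ∃ x y : WittSemiring F, ξ = ι x - ι y ∧ x.size + y.size < s := by
  obtain ⟨x₀, y₀, h₀⟩ := exists_sub ξ
  obtain ⟨_, ⟨x, y, hxy, rfl⟩, hs⟩ := exists_lt_of_csInf_lt
    (s := {s : ℝ | ∃ x y : WittSemiring F, ξ = ι x - ι y ∧ s = x.size + y.size})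
    ⟨_, x₀, y₀, h₀, rfl⟩ h
  exact ⟨x, y, hxy, hs⟩

/-- `wittNorm` is a ring seminorm. -/
noncomputable def wittSeminorm : RingSeminorm (WittRing F) where
  toFun := wittNorm
  map_zero' := le_antisymm
    (by simpa [WittSemiring.size_zero] using wittNorm_le (0 : WittSemiring F) 0)
    (wittNorm_nonneg _)
  neg' ξ := by
    have key : ∀ ξ : WittRing F, wittNorm (-ξ) ≤ wittNorm ξ := by
      intro ξ
      refine le_of_forall_gt_imp_ge_of_dense fun a ha => ?_
      obtain ⟨x, y, rfl, h⟩ := exists_of_wittNorm_lt ha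
      rw [neg_sub]
      exact (wittNorm_le y x).trans (by linarith)
    exact le_antisymm (key ξ) (by simpa using key (-ξ))
  add_le' ξ η := by
    refine le_of_forall_pos_le_add fun ε hε => ?_
    obtain ⟨x, y, rfl, h⟩ := exists_of_wittNorm_lt (show wittNorm ξ < wittNorm ξ + ε / 2 by linarith)
    obtain ⟨z, w, rfl, h'⟩ :=
      exists_of_wittNorm_lt (show wittNorm η < wittNorm η + ε / 2 by linarith)
    have e : ι x - ι y + (ι z - ι w) = ι (x + z) - ι (y + w) := by
      rw [map_add, map_add]; abel
    have h1 := wittNorm_le (x + z) (y + w)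
    rw [← e] at h1
    have := WittSemiring.size_add x z
    have := WittSemiring.size_add y w
    linarith
  mul_le' ξ η := by
    refine le_of_forall_gt_imp_ge_of_dense fun a ha => ?_
    have hcont : Filter.Tendsto (fun δ : ℝ => (wittNorm ξ + δ) * (wittNorm η + δ))
        (nhdsWithin 0 (Set.Ioi 0)) (nhds ((wittNorm ξ + 0) * (wittNorm η + 0))) :=
      (Continuous.tendsto (by fun_prop) 0).mono_left nhdsWithin_le_nhds
    rw [add_zero, add_zero] at hcont
    obtain ⟨δ, hδa, hδ⟩ := ((hcont.eventually (gt_mem_nhds ha)).and self_mem_nhdsWithin).exists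
    have hδ' : 0 < δ := hδ
    obtain ⟨x, y, hξ, h⟩ := exists_of_wittNorm_lt (show wittNorm ξ < wittNorm ξ + δ by linarith)
    obtain ⟨z, w, hη, h'⟩ := exists_of_wittNorm_lt (show wittNorm η < wittNorm η + δ by linarith)
    have e : ξ * η = ι (x * z + y * w) - ι (x * w + y * z) := by
      rw [hξ, hη, map_add, map_add, ι_mul, ι_mul, ι_mul, ι_mul]; ring
    have h1 := wittNorm_le (x * z + y * w) (x * w + y * z)
    rw [← e] at h1
    have h2 := WittSemiring.size_add (x * z) (y * w)
    have h3 := WittSemiring.size_add (x * w) (y * z)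
    have h4 := WittSemiring.size_mul x z
    have h5 := WittSemiring.size_mul y w
    have h6 := WittSemiring.size_mul x w
    have h7 := WittSemiring.size_mul y z
    have h8 : (x.size + y.size) * (z.size + w.size) ≤ (wittNorm ξ + δ) * (wittNorm η + δ) :=
      mul_le_mul h.le h'.le (add_nonneg z.size_nonneg w.size_nonneg)
        (by linarith [wittNorm_nonneg ξ])
    linarith

noncomputable instance instSeminormedCommRing : SeminormedCommRing (WittRing F) where
  __ := wittSeminorm.toSeminormedRing
  mul_comm := mul_comm

theorem norm_eq (ξ : WittRing F) : ‖ξ‖ = wittNorm ξ := rfl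

/-- A real number `t` in the Witt ring: the difference of its positive and negative parts. -/
noncomputable def ofReal (t : ℝ) : WittRing F :=
  ι (WittSemiring.const t.toNNReal) - ι (WittSemiring.const (-t).toNNReal)

theorem ofReal_sub (a b : ℝ≥0) :
    (ofReal ((a : ℝ) - b) : WittRing F) = ι (WittSemiring.const a) - ι (WittSemiring.const b) := by
  rw [ofReal, sub_eq_sub_iff_add_eq_add]
  simp only [← map_add]
  congr 2
  apply NNReal.coe_injective
  push_cast
  simp only [Real.coe_toNNReal', neg_sub]
  rcases le_total (a : ℝ) b with h | h
  · rw [max_eq_right (by linarith), max_eq_left (by linarith)]; ring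
  · rw [max_eq_left (by linarith), max_eq_right (by linarith)]; ring

theorem exists_nnreal_sub (t : ℝ) : ∃ a b : ℝ≥0, t = (a : ℝ) - b :=
  ⟨t.toNNReal, (-t).toNNReal, by
    simp only [Real.coe_toNNReal']
    rcases le_total 0 t with h | h
    · rw [max_eq_left h, max_eq_right (by linarith)]; ring
    · rw [max_eq_right h, max_eq_left (by linarith)]; ring⟩

/-- The inclusion of the real numbers in the Witt ring, as a ring homomorphism. -/
noncomputable def realHom : ℝ →+* WittRing F where
  toFun := ofReal
  map_zero' := by simpa using ofReal_sub (F := F) 0 0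
  map_one' := by simpa [ι_one] using ofReal_sub (F := F) 1 0
  map_add' s t := by
    obtain ⟨a, b, rfl⟩ := exists_nnreal_sub s
    obtain ⟨c, d, rfl⟩ := exists_nnreal_sub t
    have h := ofReal_sub (F := F) (a + c) (b + d)
    push_cast at h
    rw [show (a : ℝ) - b + (c - d) = a + c - (b + d) by ring, h, ofReal_sub, ofReal_sub]
    simp only [map_add]
    abel
  map_mul' s t := by
    obtain ⟨a, b, rfl⟩ := exists_nnreal_sub s
    obtain ⟨c, d, rfl⟩ := exists_nnreal_sub t
    have h := ofReal_sub (F := F) (a * c + b * d) (a * d + b * c)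
    push_cast at h
    rw [show ((a : ℝ) - b) * (c - d) = a * c + b * d - (a * d + b * c) by ring, h, ofReal_sub,
      ofReal_sub]
    simp only [map_add, map_mul, ι_mul]
    ring

theorem norm_ofReal_le (t : ℝ) : ‖(ofReal t : WittRing F)‖ ≤ |t| := by
  refine (wittNorm_le _ _).trans ?_
  refine (add_le_add (WittSemiring.size_le le_rfl) (WittSemiring.size_le le_rfl)).trans ?_
  simp only [Real.coe_toNNReal']
  rcases le_total 0 t with h | h
  · rw [max_eq_left h, max_eq_right (by linarith), abs_of_nonneg h]; linarith
  · rw [max_eq_right h, max_eq_left (by linarith), abs_of_nonpos h]; linarith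

noncomputable instance instAlgebra : Algebra ℝ (WittRing F) := realHom.toAlgebra

noncomputable instance instNormedAlgebra : NormedAlgebra ℝ (WittRing F) where
  norm_smul_le t ξ := by
    rw [Algebra.smul_def, Real.norm_eq_abs]
    refine (norm_mul_le _ _).trans ?_
    gcongr
    exact norm_ofReal_le t

end WittRing

/-- The real Banach algebra of Witt vectors: the completion of the Witt ring for its norm. -/
abbrev WittBanach (F : Type u) [BanachSemifield F] : Type u := UniformSpace.Completion (WittRing F)

/-- The class in the Witt Banach algebra of an element of `F`. -/
noncomputable def WittBanach.teichmuller {F : Type u} [BanachSemifield F] (X : F) : WittBanach F :=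
  ((WittRing.ι (WittSemiring.of X) : WittRing F) : UniformSpace.Completion (WittRing F))

/-- A character of `(F, ⊕, +)` with values in `(ℝ, max, +)`. -/
structure IsTropicalCharacter {F : Type u} [PerfectSemifield F] (φ : F → ℝ) : Prop where
  ne_zero : ∃ X, φ X ≠ 0
  map_oplus : ∀ X Y, φ (oplus X Y) = max (φ X) (φ Y)
  map_add : ∀ X Y, φ (X + Y) = φ X + φ Y

/-- The spectrum `S_E(F)`: the characters `φ` with `φ(E) = 1`. -/
def TropicalSpectrum (F : Type u) [BanachSemifield F] : Type u :=
  {φ : F → ℝ // IsTropicalCharacter φ ∧ φ E = 1}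

/-- The weakest topology making all the maps `φ ↦ φ(X)` continuous. -/
instance TropicalSpectrum.instTopologicalSpace (F : Type u) [BanachSemifield F] :
    TopologicalSpace (TropicalSpectrum F) :=
  ⨅ X : F, TopologicalSpace.induced (fun φ => φ.1 X) inferInstance

/-- The spectrum of a commutative complex Banach algebra: the set of its unital complex-valued
algebra homomorphisms (they are automatically continuous). -/
def GelfandSpectrum (A : Type u) [CommRing A] [Algebra ℂ A] : Type u := A →ₐ[ℂ] ℂ

/-- The Gelfand topology: the weakest topology making all the maps `χ ↦ χ(a)` continuous. -/
noncomputable instance GelfandSpectrum.instTopologicalSpace (A : Type u) [CommRing A] [Algebra ℂ A] :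
    TopologicalSpace (GelfandSpectrum A) :=
  ⨅ a : A, TopologicalSpace.induced (fun χ : A →ₐ[ℂ] ℂ => χ a) inferInstance

/-- The value of a point of the Gelfand spectrum at an element of the algebra. -/
noncomputable def GelfandSpectrum.eval {A : Type u} [CommRing A] [Algebra ℂ A] (χ : GelfandSpectrum A) (a : A) :
    ℂ :=
  (show A →ₐ[ℂ] ℂ from χ) a

/-! The correspondence is $\chi_\varphi([X]) = e^{\varphi(X)}$, and the work is to show that each
side produces the other.

From $\varphi$ to $\chi$. Since $\varphi(E)=1$, a tropical character is bounded by the norm, so it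
is real-linear and commutes with least upper bounds of compact sets. Applied to $+_w$ this turns the
Witt sum into $\sup_\alpha (S(\alpha)+\alpha x+(1-\alpha)y)$ with $x=\varphi(X)$, $y=\varphi(Y)$,
which is $\log(e^x+e^y)$ by the Gibbs variational formula (`gibbs`, `gibbs_eq`). So $e^\varphi$ is
additive for $+_w$ (`exp_map_wadd`) and is a semiring homomorphism. It is monotone and fixes the
constants, hence is bounded by `size`. It therefore extends contractively to the Witt ring and its
completion, and then to the complexification.

From $\chi$ to $\varphi$. The restriction of $\chi$ to the real Banach algebra is contractive
(`norm_realAlgHom_le`). The key point is that $\chi([X])>0$ (`arg_map_teichmuller`). Otherwise some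
power $w=\chi([nX])$ has negative real part, so $w$ is a root of $T^2-2\,\mathrm{Re}(w)\,T+|w|^2$,
whose coefficients are positive. Its value at $[nX]$ is a sum of classes of elements of $\mathcal
F$, hence again the class of an element of $\mathcal F$, hence invertible, yet $\chi$ kills it.

Put $\varphi=\log\chi([\cdot])$. Additivity is clear, and contractivity gives monotonicity because
$X\le Y$ implies $\|[X-Y]\|\le 1$. The passage from sums to maxima (`logChar_sup`) is a tropical
limit: $n(X\oplus Y)\le nX+_w nY$ yields $e^{n\varphi(X\oplus Y)}\le
2e^{n\max(\varphi(X),\varphi(Y))}$ for all $n\ge 1$.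

The two constructions are mutually inverse because differences of classes are dense. Both topologies
are weak topologies, so continuity is checked on evaluations; for a general element of the
completion, approximation is uniform in $\varphi$ by contractivity. -/

namespace IsTropicalCharacter

variable {F : Type u} [BanachSemifield F] {φ : F → ℝ}

/-! ### Order, linearity and continuity of tropical characters -/

theorem mono {F : Type u} [PerfectSemifield F] {φ : F → ℝ} (hφ : IsTropicalCharacter φ)
    {X Y : F} (h : X ≤ Y) : φ X ≤ φ Y := by
  rw [← (le_def X Y).1 h, hφ.map_oplus]
  exact le_max_left _ _

/-- A tropical character as an additive homomorphism. -/
def toAddMonoidHom {F : Type u} [PerfectSemifield F] {φ : F → ℝ} (hφ : IsTropicalCharacter φ) :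
    F →+ ℝ :=
  AddMonoidHom.mk' φ hφ.map_add

theorem map_rat_smul {F : Type u} [PerfectSemifield F] {φ : F → ℝ} (hφ : IsTropicalCharacter φ)
    (q : ℚ) (X : F) : φ (q • X) = q * φ X := by
  have := _root_.map_rat_smul hφ.toAddMonoidHom q X
  rwa [Rat.smul_def] at this

/-- Continuity of `φ` is not assumed but forced: `φ` is monotone and sends `q • E` to `q`, so the
bounds defining the radius pass to real numbers. This is what upgrades rational linearity to real
linearity. -/
theorem abs_le_norm (hφ : IsTropicalCharacter φ) (hE : φ E = 1) (X : F) : |φ X| ≤ ‖X‖ := by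
  refine le_of_forall_gt_imp_ge_of_dense fun a ha => ?_
  obtain ⟨q, h₁, h₂⟩ := exists_rat_btwn ha
  obtain ⟨-, h3, h4⟩ := of_radius_lt h₁
  have h5 := hφ.mono h3
  have h6 := hφ.mono h4
  have h7 : φ (-(q • E)) = -φ (q • E) := map_neg hφ.toAddMonoidHom _
  rw [h7, hφ.map_rat_smul, hE, mul_one] at h5
  rw [hφ.map_rat_smul, hE, mul_one] at h6
  exact (abs_le.2 ⟨h5, h6⟩).trans h₂.le

theorem continuous (hφ : IsTropicalCharacter φ) (hE : φ E = 1) : Continuous φ :=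
  AddMonoidHomClass.continuous_of_bound hφ.toAddMonoidHom 1
    fun X => (hφ.abs_le_norm hE X).trans_eq (one_mul _).symm

theorem map_real_smul (hφ : IsTropicalCharacter φ) (hE : φ E = 1) (t : ℝ) (X : F) :
    φ (t • X) = t * φ X := by
  refine Rat.isDenseEmbedding_coe_real.dense.induction_on (p := fun t : ℝ =>
    φ (t • X) = t * φ X) t (isClosed_eq ((hφ.continuous hE).comp (continuous_real_smul X))
    (by fun_prop)) (fun q => ?_)
  rw [rat_cast_smul, hφ.map_rat_smul]

/-! ### Tropical characters on least upper bounds and on the Witt addition -/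

/-- A tropical character is compatible with least upper bounds of compact sets. -/
theorem le_of_isLUB (hφ : IsTropicalCharacter φ) (hE : φ E = 1) {K : Set F} (hK : IsCompact K)
    (hne : K.Nonempty) {S : F} (hS : IsLUB K S) {c : ℝ} (hc : ∀ X ∈ K, φ X ≤ c) : φ S ≤ c := by
  refine le_of_forall_pos_le_add fun ε hε => ?_
  -- Take a finite `ε`-net of `K`. Its finite supremum plus `ε • E` bounds `K` above, hence bounds
  -- `S`. On a finite supremum `φ` is a maximum, so only `ε` is lost.
  obtain ⟨t, htK, htf, hcov⟩ := hK.finite_cover_balls hε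
  have hne' : htf.toFinset.Nonempty := by
    obtain ⟨x, hx⟩ := hne
    obtain ⟨y, hy, -⟩ := Set.mem_iUnion₂.1 (hcov hx)
    exact ⟨y, by simpa using hy⟩
  have h1 : S ≤ htf.toFinset.sup' hne' id + ε • E := by
    refine hS.2 fun X hX => ?_
    obtain ⟨y, hy, hXy⟩ := Set.mem_iUnion₂.1 (hcov hX)
    have h2 : X - y ≤ ε • E := by
      refine ((le_abs_self _).trans (abs_le_norm_smul _)).trans
        (real_smul_le_smul_right ?_ E_nonneg)
      rw [← dist_eq_norm]; exact (Metric.mem_ball.1 hXy).le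
    calc X ≤ y + ε • E := by rwa [← sub_le_iff_le_add']
      _ ≤ _ := by
        gcongr
        exact Finset.le_sup' id (by simpa using hy)
  have h3 : φ (htf.toFinset.sup' hne' id) ≤ c := by
    refine Finset.sup'_induction hne' id (p := fun X => φ X ≤ c) (fun X hX Y hY => ?_)
      (fun X hX => hc X (htK (by simpa using hX)))
    exact (hφ.map_oplus X Y).trans_le (max_le hX hY)
  have h4 := hφ.mono h1
  rw [hφ.map_add, hφ.map_real_smul hE, hE, mul_one] at h4
  linarith

theorem map_mix (hφ : IsTropicalCharacter φ) (hE : φ E = 1) (X Y : F) (α : ℝ) :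
    φ (mix X Y α) = Real.binEntropy α + α * φ X + (1 - α) * φ Y := by
  rw [mix, hφ.map_add, hφ.map_add, hφ.map_real_smul hE, hφ.map_real_smul hE,
    hφ.map_real_smul hE, hE, mul_one]

/-- This is the reason for the entropy weights: the Legendre-type supremum of `S(α) + α x + (1 - α)
y` over `[0, 1]` is `log (exp x + exp y)`. Compactness of the family of mixed terms lets `φ` pass
through the least upper bound. -/
theorem exp_map_wadd (hφ : IsTropicalCharacter φ) (hE : φ E = 1) (X Y : F) :
    Real.exp (φ (wadd X Y)) = Real.exp (φ X) + Real.exp (φ Y) := by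
  have hX := Real.exp_pos (φ X)
  have hY := Real.exp_pos (φ Y)
  suffices h : φ (wadd X Y) = Real.log (Real.exp (φ X) + Real.exp (φ Y)) by
    rw [h, Real.exp_log (by positivity)]
  apply le_antisymm
  · refine hφ.le_of_isLUB hE (isCompact_Icc.image ?_) (Set.Nonempty.image _ ⟨0, by simp⟩)
      (isLUB_wadd X Y) ?_
    · exact (((continuous_real_smul _).comp Real.binEntropy_continuous).add
        (continuous_real_smul X)).add ((continuous_real_smul Y).comp (by fun_prop))
    · rintro _ ⟨α, hα, rfl⟩
      rw [hφ.map_mix hE]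
      simpa using gibbs hX hY hα
  -- The supremum is attained at the Gibbs weight `α = exp (φ X) / (exp (φ X) + exp (φ Y))`, so a
  -- single mixed term suffices.
  · rw [← gibbs_eq hX hY, Real.log_exp, Real.log_exp, ← hφ.map_mix hE]
    exact hφ.mono (mix_le_wadd _ _ ⟨by positivity, (div_le_one (by linarith)).2 (by linarith)⟩)

/-! ### From a tropical character to a character of the Witt Banach algebra -/

/-- The homomorphism `X ↦ exp (φ X)`, `-∞ ↦ 0`, on the Witt semiring. -/
noncomputable def expHom (hφ : IsTropicalCharacter φ) (hE : φ E = 1) : WittSemiring F →+* ℝ where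
  toFun x := match x with
    | none => 0
    | some X => Real.exp (φ (Multiplicative.toAdd X))
  map_zero' := rfl
  map_one' := by
    change Real.exp (φ 0) = 1
    rw [show φ 0 = 0 from map_zero hφ.toAddMonoidHom, Real.exp_zero]
  map_add' x y := by
    induction x using WittSemiring.ind with
    | zero => rw [zero_add]; exact (zero_add _).symm
    | coe X =>
      induction y using WittSemiring.ind with
      | zero => rw [add_zero]; exact (add_zero _).symm
      | coe Y => exact hφ.exp_map_wadd hE X Y
  map_mul' x y := by
    induction x using WittSemiring.ind with
    | zero => rw [zero_mul]; exact (zero_mul _).symm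
    | coe X =>
      induction y using WittSemiring.ind with
      | zero => rw [mul_zero]; exact (mul_zero _).symm
      | coe Y =>
        change Real.exp (φ (X + Y)) = Real.exp (φ X) * Real.exp (φ Y)
        rw [hφ.map_add, Real.exp_add]

theorem expHom_of (hφ : IsTropicalCharacter φ) (hE : φ E = 1) (X : F) :
    hφ.expHom hE (WittSemiring.of X) = Real.exp (φ X) := rfl

theorem expHom_nonneg (hφ : IsTropicalCharacter φ) (hE : φ E = 1) (x : WittSemiring F) :
    0 ≤ hφ.expHom hE x := by
  induction x using WittSemiring.ind with
  | zero => rw [map_zero]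
  | coe X => exact (Real.exp_pos _).le

theorem expHom_mono (hφ : IsTropicalCharacter φ) (hE : φ E = 1) {x y : WittSemiring F}
    (h : x ≤ y) : hφ.expHom hE x ≤ hφ.expHom hE y := by
  induction x using WittSemiring.ind with
  | zero => rw [map_zero]; exact hφ.expHom_nonneg hE y
  | coe X =>
    induction y using WittSemiring.ind with
    | zero => rw [le_antisymm h (WittSemiring.zero_le' _)]
    | coe Y => exact Real.exp_le_exp.2 (hφ.mono (WittSemiring.of_le_of.1 h))

theorem expHom_const (hφ : IsTropicalCharacter φ) (hE : φ E = 1) (s : ℝ≥0) :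
    hφ.expHom hE (WittSemiring.const s) = s := by
  rcases eq_or_ne s 0 with rfl | hs
  · simp
  · rw [WittSemiring.const_of_ne_zero hs, expHom_of, hφ.map_real_smul hE, hE, mul_one,
      Real.exp_log (by positivity)]

/-- A bound of `x` by a constant `t` is preserved by the monotone `expHom`, which fixes constants.
The contractivity of all later extensions comes from here. -/
theorem expHom_le_size (hφ : IsTropicalCharacter φ) (hE : φ E = 1) (x : WittSemiring F) :
    hφ.expHom hE x ≤ x.size := by
  refine le_of_forall_gt_imp_ge_of_dense fun a ha => ?_
  obtain ⟨t, ht, hta⟩ := WittSemiring.exists_of_size_lt ha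
  have := hφ.expHom_mono hE ht
  rw [hφ.expHom_const hE] at this
  exact this.trans hta.le

/-- The real character of the Witt ring given by a tropical character. -/
noncomputable def wittHom (hφ : IsTropicalCharacter φ) (hE : φ E = 1) : WittRing F →ₐ[ℝ] ℝ where
  __ := WittRing.lift (hφ.expHom hE : WittSemiring F →+ ℝ)
  map_one' := by
    change WittRing.lift _ (WittRing.ι 1) = 1
    rw [WittRing.lift_ι]; exact map_one (hφ.expHom hE)
  map_mul' ξ η := by
    obtain ⟨x, y, rfl⟩ := WittRing.exists_sub ξ
    obtain ⟨z, w, rfl⟩ := WittRing.exists_sub η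
    have e : (WittRing.ι x - WittRing.ι y) * (WittRing.ι z - WittRing.ι w) =
        WittRing.ι (x * z) - WittRing.ι (x * w) - (WittRing.ι (y * z) - WittRing.ι (y * w)) := by
      simp only [WittRing.ι_mul]; ring
    simp only [e, ZeroHom.toFun_eq_coe, AddMonoidHom.toZeroHom_coe, map_sub, WittRing.lift_ι,
      AddMonoidHom.coe_coe, map_mul]
    ring
  commutes' t := by
    change WittRing.lift _ (WittRing.ι _ - WittRing.ι _) = t
    rw [map_sub, WittRing.lift_ι, WittRing.lift_ι]
    simp only [AddMonoidHom.coe_coe, hφ.expHom_const hE, Real.coe_toNNReal']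
    rcases le_total 0 t with h | h
    · rw [max_eq_left h, max_eq_right (by linarith)]; ring
    · rw [max_eq_right h, max_eq_left (by linarith)]; ring

theorem wittHom_ι (hφ : IsTropicalCharacter φ) (hE : φ E = 1) (x : WittSemiring F) :
    hφ.wittHom hE (WittRing.ι x) = hφ.expHom hE x :=
  WittRing.lift_ι _ _

theorem norm_wittHom_le (hφ : IsTropicalCharacter φ) (hE : φ E = 1) (ξ : WittRing F) :
    ‖hφ.wittHom hE ξ‖ ≤ ‖ξ‖ := by
  refine le_of_forall_gt_imp_ge_of_dense fun a ha => ?_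
  obtain ⟨x, y, rfl, h⟩ := WittRing.exists_of_wittNorm_lt ha
  rw [map_sub, hφ.wittHom_ι hE, hφ.wittHom_ι hE]
  refine (norm_sub_le _ _).trans ?_
  rw [Real.norm_of_nonneg (hφ.expHom_nonneg hE x), Real.norm_of_nonneg (hφ.expHom_nonneg hE y)]
  linarith [hφ.expHom_le_size hE x, hφ.expHom_le_size hE y]

theorem continuous_wittHom (hφ : IsTropicalCharacter φ) (hE : φ E = 1) :
    Continuous (hφ.wittHom hE) :=
  AddMonoidHomClass.continuous_of_bound (hφ.wittHom hE) 1
    fun ξ => by simpa using hφ.norm_wittHom_le hE ξ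

/-- The continuous extension of `wittHom` to the Witt Banach algebra. -/
noncomputable def banachHom (hφ : IsTropicalCharacter φ) (hE : φ E = 1) :
    WittBanach F →ₐ[ℝ] ℝ where
  __ := UniformSpace.Completion.extensionHom (hφ.wittHom hE : WittRing F →+* ℝ)
    (hφ.continuous_wittHom hE)
  commutes' t :=
    (UniformSpace.Completion.extensionHom_coe (hφ.wittHom hE : WittRing F →+* ℝ)
      (hφ.continuous_wittHom hE) (algebraMap ℝ (WittRing F) t)).trans ((hφ.wittHom hE).commutes t)

theorem banachHom_coe (hφ : IsTropicalCharacter φ) (hE : φ E = 1) (ξ : WittRing F) :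
    hφ.banachHom hE (ξ : WittBanach F) = hφ.wittHom hE ξ :=
  UniformSpace.Completion.extensionHom_coe _ (hφ.continuous_wittHom hE) ξ

theorem banachHom_teichmuller (hφ : IsTropicalCharacter φ) (hE : φ E = 1) (X : F) :
    hφ.banachHom hE (WittBanach.teichmuller X) = Real.exp (φ X) := by
  rw [WittBanach.teichmuller, banachHom_coe, wittHom_ι, expHom_of]

theorem continuous_banachHom (hφ : IsTropicalCharacter φ) (hE : φ E = 1) :
    Continuous (hφ.banachHom hE) :=
  UniformSpace.Completion.continuous_extension

/-- The constant 1 does not depend on `φ`; this uniformity gives the continuity of evaluations on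
the tropical spectrum. -/
theorem norm_banachHom_le (hφ : IsTropicalCharacter φ) (hE : φ E = 1) (a : WittBanach F) :
    ‖hφ.banachHom hE a‖ ≤ ‖a‖ := by
  induction a using UniformSpace.Completion.induction_on with
  | hp => exact isClosed_le (hφ.continuous_banachHom hE).norm continuous_norm
  | ih ξ =>
    rw [banachHom_coe, UniformSpace.Completion.norm_coe]
    exact hφ.norm_wittHom_le hE ξ

/-- The complex character of the complexified Witt Banach algebra given by a tropical
character. -/
noncomputable def complexHom (hφ : IsTropicalCharacter φ) (hE : φ E = 1) :
    ℂ ⊗[ℝ] WittBanach F →ₐ[ℂ] ℂ :=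
  Algebra.TensorProduct.lift (AlgHom.id ℂ ℂ) (Complex.ofRealAm.comp (hφ.banachHom hE))
    fun _ _ => Commute.all _ _

theorem complexHom_tmul (hφ : IsTropicalCharacter φ) (hE : φ E = 1) (z : ℂ) (a : WittBanach F) :
    hφ.complexHom hE (z ⊗ₜ a) = z * (hφ.banachHom hE a : ℝ) := by
  simp [complexHom]

end IsTropicalCharacter

/-! ### Contractivity of complex-valued characters of real Banach algebras -/

section BanachCharacter

variable {A : Type*} [NormedRing A] [NormedAlgebra ℝ A] [CompleteSpace A]

/-- A crude bound obtained without complexifying `A`, so no norm on the tensor product is needed. As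
`χ a` need not be real, the linear factor of the usual Neumann series argument is replaced by the
real quadratic with roots `χ a` and its conjugate. -/
theorem norm_realAlgHom_le_three_mul (χ : A →ₐ[ℝ] ℂ) (a : A) : ‖χ a‖ ≤ 3 * ‖a‖ := by
  by_contra! h
  set z := χ a with hz
  have hr : 0 < ‖z‖ := lt_of_le_of_lt (by positivity) h
  -- Here `1 - b` is `(a ^ 2 - 2 Re(z) a + ‖z‖ ^ 2) / ‖z‖ ^ 2`, which `χ` sends to 0. The factor 3
  -- makes `b` small, since `2/3 + 1/9 < 1`, so `1 - b` is a unit.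
  set b : A := (‖z‖ ^ 2)⁻¹ • ((2 * z.re) • a - a ^ 2) with hb
  have hb1 : ‖b‖ < 1 := by
    have h1 : ‖(2 * z.re) • a‖ ≤ 2 * ‖z‖ * ‖a‖ := by
      refine (norm_smul_le _ _).trans ?_
      gcongr
      rw [norm_mul, Real.norm_ofNat]
      gcongr
      exact Complex.abs_re_le_norm z
    have h2 : ‖a ^ 2‖ ≤ ‖a‖ ^ 2 := norm_pow_le' a two_pos
    have h3 : ‖(2 * z.re) • a - a ^ 2‖ < ‖z‖ ^ 2 := by
      refine (norm_sub_le _ _).trans_lt ?_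
      nlinarith [norm_nonneg a]
    calc ‖b‖ ≤ ‖(‖z‖ ^ 2)⁻¹‖ * ‖(2 * z.re) • a - a ^ 2‖ := norm_smul_le _ _
      _ = (‖z‖ ^ 2)⁻¹ * ‖(2 * z.re) • a - a ^ 2‖ := by rw [Real.norm_of_nonneg (by positivity)]
      _ < 1 := by rwa [inv_mul_lt_iff₀ (by positivity), mul_one]
  have hu := (isUnit_one_sub_of_norm_lt_one hb1).map χ
  refine hu.ne_zero ?_
  have hn : (‖z‖ : ℂ) ^ 2 = z * (starRingEnd ℂ) z := (Complex.mul_conj' z).symm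
  have hre : 2 * (z.re : ℂ) = z + (starRingEnd ℂ) z := by rw [Complex.add_conj]; push_cast; ring
  have hne : (‖z‖ : ℂ) ^ 2 ≠ 0 := by exact_mod_cast (pow_pos hr 2).ne'
  rw [hb, map_sub, map_one, map_smul, map_sub, map_smul, map_pow, ← hz, Complex.real_smul,
    Complex.real_smul]
  push_cast
  rw [hre, sub_eq_zero, eq_comm, inv_mul_eq_iff_eq_mul₀ hne, hn]
  ring

/-- A complex-valued character of a real Banach algebra is contractive. -/
theorem norm_realAlgHom_le (χ : A →ₐ[ℝ] ℂ) (a : A) : ‖χ a‖ ≤ ‖a‖ := by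
  by_contra! h
  rcases (norm_nonneg a).eq_or_lt with h0 | h0
  · have := norm_realAlgHom_le_three_mul χ a
    rw [← h0] at this h
    linarith
  -- Power trick: applying the crude bound to `a ^ n` shows that the `n`-th power of `‖χ a‖ / ‖a‖`
  -- is at most 3 for each `n > 0`. Positivity of `n` matters because `‖1‖ = 1` is not assumed.
  · obtain ⟨n, hn⟩ := pow_unbounded_of_one_lt 3 ((one_lt_div h0).2 h)
    rcases Nat.eq_zero_or_pos n with rfl | hpos
    · norm_num at hn
    · have h1 := norm_realAlgHom_le_three_mul χ (a ^ n)
      have h2 := norm_pow_le' a hpos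
      rw [map_pow, norm_pow] at h1
      rw [div_pow, lt_div_iff₀ (by positivity)] at hn
      linarith

end BanachCharacter

/-! ### Rotating a complex number into the left half-plane -/

/-- A complex number off the half-line `[0, ∞)` has a power with negative real part. -/
theorem Complex.exists_pow_re_neg {z : ℂ} (hz : z.arg ≠ 0) :
    ∃ n : ℕ, (z ^ n).re < 0 := by
  have hz0 : z ≠ 0 := fun h => hz (by rw [h, Complex.arg_zero])
  have hθ : 0 < |z.arg| := abs_pos.2 hz
  have hπ := Complex.abs_arg_le_pi z
  obtain ⟨n, hn1, hn2⟩ : ∃ n : ℕ,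
      Real.pi / 2 < n * |z.arg| ∧ n * |z.arg| < Real.pi + Real.pi / 2 := by
    -- If `|arg z| ≤ π / 2`, the first multiple beyond `π / 2` overshoots it by at most `|arg z|`,
    -- so it is at most `π`. Otherwise `|arg z|` itself lies in `(π / 2, π]`.
    rcases le_or_gt |z.arg| (Real.pi / 2) with h | h
    · refine ⟨⌊Real.pi / 2 / |z.arg|⌋₊ + 1, ?_, ?_⟩
      · have := Nat.lt_floor_add_one (Real.pi / 2 / |z.arg|)
        rw [div_lt_iff₀ hθ] at this
        exact_mod_cast this
      · have := Nat.floor_le (show 0 ≤ Real.pi / 2 / |z.arg| by positivity)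
        rw [le_div_iff₀ hθ] at this
        push_cast
        linarith [Real.pi_pos]
    · exact ⟨1, by simpa using h, by simpa using by linarith [Real.pi_pos]⟩
  refine ⟨n, ?_⟩
  have e : z ^ n = ((‖z‖ ^ n : ℝ) : ℂ) * Complex.exp (((n * z.arg : ℝ) : ℂ) * Complex.I) := by
    conv_lhs => rw [← Complex.norm_mul_exp_arg_mul_I z, mul_pow, ← Complex.exp_nat_mul]
    push_cast
    rw [mul_assoc]
  rw [e, Complex.re_ofReal_mul, Complex.exp_ofReal_mul_I_re, ← Real.cos_abs, abs_mul, Nat.abs_cast]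
  exact mul_neg_of_pos_of_neg (pow_pos (norm_pos_iff.2 hz0) n)
    (Real.cos_neg_of_pi_div_two_lt_of_lt hn1 hn2)

/-! ### Classes of elements of `F` and positivity of characters on them -/

namespace WittBanach

variable {F : Type u} [BanachSemifield F]

theorem teichmuller_zero : teichmuller (0 : F) = 1 := rfl

theorem teichmuller_add (X Y : F) : teichmuller (X + Y) = teichmuller X * teichmuller Y := by
  rw [teichmuller, ← WittSemiring.of_mul_of, WittRing.ι_mul, UniformSpace.Completion.coe_mul]
  rfl

theorem teichmuller_wadd (X Y : F) :
    teichmuller (wadd X Y) = teichmuller X + teichmuller Y := by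
  rw [teichmuller, ← WittSemiring.of_add_of, map_add, UniformSpace.Completion.coe_add]
  rfl

theorem teichmuller_nsmul (n : ℕ) (X : F) : teichmuller (n • X) = teichmuller X ^ n := by
  induction n with
  | zero => rw [zero_smul, pow_zero, teichmuller_zero]
  | succ n ih => rw [succ_nsmul, teichmuller_add, ih, pow_succ]

theorem teichmuller_log_smul {s : ℝ} (hs : 0 < s) :
    teichmuller (Real.log s • (E : F)) = algebraMap ℝ (WittBanach F) s := by
  have h : algebraMap ℝ (WittRing F) s = WittRing.ι (WittSemiring.of (Real.log s • E)) := by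
    change WittRing.ofReal s = _
    rw [WittRing.ofReal, Real.toNNReal_of_nonpos (by linarith : -s ≤ 0), map_zero, map_zero,
      sub_zero, WittSemiring.const_of_ne_zero (by simpa using hs), Real.coe_toNNReal _ hs.le]
  rw [teichmuller, ← h]
  rfl

theorem isUnit_teichmuller (X : F) : IsUnit (teichmuller X) :=
  IsUnit.of_mul_eq_one (teichmuller (-X)) (by
    rw [← teichmuller_add, add_neg_cancel, teichmuller_zero])

/-- Only an upper bound on `X` is needed, because `size` is defined by upper bounds alone. The norm
therefore sees the order of `F`. -/
theorem norm_teichmuller_le {X : F} {t : ℝ} (h : X ≤ t • E) :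
    ‖teichmuller X‖ ≤ Real.exp t := by
  rw [teichmuller, UniformSpace.Completion.norm_coe, WittRing.norm_eq]
  have h1 := WittRing.wittNorm_le (WittSemiring.of X) 0
  rw [map_zero, sub_zero, WittSemiring.size_zero, add_zero] at h1
  refine h1.trans ?_
  have h2 := WittSemiring.size_le (x := WittSemiring.of X) (t := (Real.exp t).toNNReal) (by
    rw [WittSemiring.const_of_ne_zero (by simpa using Real.exp_pos t), WittSemiring.of_le_of,
      Real.coe_toNNReal _ (Real.exp_pos t).le, Real.log_exp]
    exact h)
  rwa [Real.coe_toNNReal _ (Real.exp_pos t).le] at h2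

variable (χ : WittBanach F →ₐ[ℝ] ℂ)

/-- A positive combination of classes of elements of `F` is invertible, so no character
kills it; hence characters are positive on such classes. -/
theorem arg_map_teichmuller (X : F) : (χ (teichmuller X)).arg = 0 := by
  by_contra h
  obtain ⟨n, hn⟩ := Complex.exists_pow_re_neg h
  set w := χ (teichmuller X) ^ n with hw
  have hwX : χ (teichmuller (n • X)) = w := by rw [teichmuller_nsmul, map_pow]
  have hw0 : 0 < ‖w‖ ^ 2 := by
    have : w ≠ 0 := fun h => by simp [h] at hn
    positivity
  have hc : 0 < -(2 * w.re) := by linarith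
  -- The class of this element of `F` is `[n X] ^ 2 - 2 Re(w) [n X] + ‖w‖ ^ 2`. Negativity of `Re w`
  -- is what allows its middle coefficient to be written as the class of a real multiple of `E`. Its
  -- image under `χ` is `w ^ 2 - (w + conj w) w + w * conj w = 0`.
  have hu := (isUnit_teichmuller (wadd (wadd (n • X + n • X)
    (Real.log (-(2 * w.re)) • E + n • X)) (Real.log (‖w‖ ^ 2) • E))).map χ
  refine hu.ne_zero ?_
  rw [teichmuller_wadd, teichmuller_wadd, teichmuller_add, teichmuller_add,
    teichmuller_log_smul hc, teichmuller_log_smul hw0, map_add, map_add, map_mul, map_mul, hwX,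
    AlgHom.commutes, AlgHom.commutes]
  have h1 : (‖w‖ : ℂ) ^ 2 = w * (starRingEnd ℂ) w := (Complex.mul_conj' w).symm
  have h2 : 2 * (w.re : ℂ) = w + (starRingEnd ℂ) w := by rw [Complex.add_conj]; push_cast; ring
  simp only [Complex.coe_algebraMap]
  push_cast
  rw [h1, h2]
  ring

/-! ### From a character of the Witt Banach algebra to a tropical character -/

/-- The tropical character attached to a character of the Witt Banach algebra. -/
noncomputable def logChar (X : F) : ℝ := Real.log ‖χ (teichmuller X)‖

/-- Not implied by `arg_map_teichmuller`, since the argument of 0 is 0 by convention; it comes from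
invertibility of the class. -/
theorem norm_map_teichmuller_pos (X : F) : 0 < ‖χ (teichmuller X)‖ :=
  norm_pos_iff.2 ((isUnit_teichmuller X).map χ).ne_zero

theorem exp_logChar (X : F) : Real.exp (logChar χ X) = ‖χ (teichmuller X)‖ :=
  Real.exp_log (norm_map_teichmuller_pos χ X)

/-- Positivity removes the norm from the definition of `logChar`. This is essential for sums, on
which a norm is only subadditive. -/
theorem map_teichmuller (X : F) : χ (teichmuller X) = (Real.exp (logChar χ X) : ℂ) := by
  conv_lhs => rw [← Complex.norm_mul_exp_arg_mul_I (χ (teichmuller X)), arg_map_teichmuller]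
  rw [exp_logChar]
  simp

theorem logChar_add (X Y : F) : logChar χ (X + Y) = logChar χ X + logChar χ Y := by
  rw [logChar, teichmuller_add, map_mul, norm_mul,
    Real.log_mul (norm_map_teichmuller_pos χ X).ne' (norm_map_teichmuller_pos χ Y).ne']
  rfl

theorem logChar_E : logChar χ (E : F) = 1 := by
  have h := teichmuller_log_smul (F := F) (Real.exp_pos 1)
  rw [Real.log_exp, one_smul] at h
  rw [logChar, h, AlgHom.commutes, Complex.coe_algebraMap, Complex.norm_real,
    Real.norm_of_nonneg (Real.exp_pos 1).le, Real.log_exp]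

theorem logChar_nsmul (n : ℕ) (X : F) : logChar χ (n • X) = n * logChar χ X := by
  rw [logChar, teichmuller_nsmul, map_pow, norm_pow, Real.log_pow, logChar]

/-- The class of `X - Y ≤ 0` has norm at most `exp 0 = 1`, and `χ` is contractive. -/
theorem logChar_mono {X Y : F} (h : X ≤ Y) : logChar χ X ≤ logChar χ Y := by
  have h1 : X - Y ≤ (0 : ℝ) • E := by rw [zero_smul]; exact sub_nonpos.2 h
  have h2 := (norm_realAlgHom_le χ _).trans (norm_teichmuller_le h1)
  rw [← exp_logChar, Real.exp_le_exp] at h2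
  have h3 := logChar_add χ (X - Y) Y
  rw [sub_add_cancel] at h3
  linarith

theorem exp_logChar_wadd (X Y : F) : Real.exp (logChar χ (wadd X Y)) =
    Real.exp (logChar χ X) + Real.exp (logChar χ Y) := by
  have h := map_teichmuller χ (wadd X Y)
  rw [teichmuller_wadd, map_add, map_teichmuller, map_teichmuller] at h
  exact_mod_cast h.symm

/-- The terms `α = 1` and `α = 0` of the Witt sum carry no entropy and are `n • X` and `n • Y`. -/
theorem nsmul_sup_le_wadd {n : ℕ} (hn : 0 < n) (X Y : F) :
    n • (X ⊔ Y) ≤ wadd (n • X) (n • Y) := by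
  have h1 := mix_le_wadd (n • X) (n • Y) (α := 1) (by simp)
  have h2 := mix_le_wadd (n • X) (n • Y) (α := 0) (by simp)
  simp only [mix, Real.binEntropy_one, Real.binEntropy_zero, zero_smul, one_smul, sub_self,
    sub_zero, zero_add, add_zero] at h1 h2
  -- Writing the right-hand side as `n` times an element lets `n` be cancelled, reducing the claim
  -- to the universal property of `X ⊔ Y`.
  rw [← nsmul_divNat hn (wadd (n • X) (n • Y))] at h1 h2 ⊢
  exact nsmul_le_nsmul_right (sup_le (le_of_nsmul_le_nsmul hn h1) (le_of_nsmul_le_nsmul hn h2)) n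

theorem logChar_sup (X Y : F) : logChar χ (X ⊔ Y) = max (logChar χ X) (logChar χ Y) := by
  apply le_antisymm _
    (max_le (logChar_mono χ le_sup_left) (logChar_mono χ le_sup_right))
  set m := max (logChar χ X) (logChar χ Y)
  -- The two-term Witt sum costs at most a factor 2, whatever `n` is. A positive gap `logChar χ (X ⊔
  -- Y) - m` would grow linearly with `n` and exceed `log 2`.
  have key : ∀ n : ℕ, 0 < n → n * (logChar χ (X ⊔ Y) - m) ≤ Real.log 2 := by
    intro n hn
    have h1 := logChar_mono χ (nsmul_sup_le_wadd hn X Y)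
    rw [← Real.exp_le_exp, exp_logChar_wadd, logChar_nsmul, logChar_nsmul, logChar_nsmul] at h1
    have h2 : Real.exp (n * logChar χ X) ≤ Real.exp (n * m) := by
      gcongr; exact le_max_left _ _
    have h3 : Real.exp (n * logChar χ Y) ≤ Real.exp (n * m) := by
      gcongr; exact le_max_right _ _
    rw [Real.le_log_iff_exp_le two_pos, mul_sub, Real.exp_sub, div_le_iff₀ (Real.exp_pos _)]
    linarith
  by_contra! h
  obtain ⟨n, hn⟩ := exists_nat_gt (Real.log 2 / (logChar χ (X ⊔ Y) - m))
  have hd : 0 < logChar χ (X ⊔ Y) - m := sub_pos.2 h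
  have hn0 : (0 : ℝ) < n := lt_of_le_of_lt (div_nonneg (Real.log_nonneg one_le_two) hd.le) hn
  rw [div_lt_iff₀ hd] at hn
  exact absurd (key n (by exact_mod_cast hn0)) (not_le.2 hn)

theorem isTropicalCharacter_logChar : IsTropicalCharacter (logChar χ) where
  ne_zero := ⟨E, by rw [logChar_E]; exact one_ne_zero⟩
  map_oplus := logChar_sup χ
  map_add := logChar_add χ

/-- Two continuous homomorphisms that agree on the classes of elements of `F` agree on their
differences, which are dense; continuity of `χ` is automatic from contractivity. -/
theorem eq_banachHom_logChar (a : WittBanach F) :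
    χ a = ((isTropicalCharacter_logChar χ).banachHom (logChar_E χ) a : ℝ) := by
  have hχ : Continuous χ := AddMonoidHomClass.continuous_of_bound χ 1
    fun b => (norm_realAlgHom_le χ b).trans_eq (one_mul _).symm
  have hT := isTropicalCharacter_logChar χ
  have hι : ∀ x : WittSemiring F, χ (WittRing.ι x : WittRing F) =
      (hT.expHom (logChar_E χ) x : ℝ) := by
    intro x
    induction x using WittSemiring.ind with
    | zero => rw [map_zero, map_zero, UniformSpace.Completion.coe_zero, map_zero]; simp
    | coe X => exact map_teichmuller χ X
  induction a using UniformSpace.Completion.induction_on with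
  | hp =>
    exact isClosed_eq hχ
      (Complex.continuous_ofReal.comp (hT.continuous_banachHom (logChar_E χ)))
  | ih ξ =>
    obtain ⟨x, y, rfl⟩ := WittRing.exists_sub ξ
    rw [hT.banachHom_coe, map_sub, hT.wittHom_ι, hT.wittHom_ι, UniformSpace.Completion.coe_sub,
      map_sub, hι, hι]
    push_cast
    rfl

end WittBanach

/-! ### Continuity of evaluations on the two spectra -/

namespace TropicalSpectrum

variable {F : Type u} [BanachSemifield F]

theorem continuous_apply (X : F) : Continuous fun φ : TropicalSpectrum F => φ.1 X :=
  continuous_iInf_dom (i := X) continuous_induced_dom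

/-- For elements of the Witt ring the evaluation is a difference of functions `exp (φ X)` or 0. A
general `a` is a limit of such elements, and contractivity makes the convergence of evaluations
uniform in `φ`. -/
theorem continuous_banachHom_apply (a : WittBanach F) :
    Continuous fun φ : TropicalSpectrum F => φ.2.1.banachHom φ.2.2 a := by
  have hι : ∀ x : WittSemiring F,
      Continuous fun φ : TropicalSpectrum F => φ.2.1.expHom φ.2.2 x := by
    intro x
    induction x using WittSemiring.ind with
    | zero => simpa only [map_zero] using continuous_const
    | coe X => exact Real.continuous_exp.comp (continuous_apply X)
  have hξ : ∀ ξ : WittRing F,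
      Continuous fun φ : TropicalSpectrum F => φ.2.1.wittHom φ.2.2 ξ := by
    intro ξ
    obtain ⟨x, y, rfl⟩ := WittRing.exists_sub ξ
    simp only [map_sub, IsTropicalCharacter.wittHom_ι]
    exact (hι x).sub (hι y)
  refine continuous_of_uniform_approx_of_continuous fun u hu => ?_
  obtain ⟨ε, hε, hεu⟩ := Metric.mem_uniformity_dist.1 hu
  obtain ⟨_, ⟨ξ, rfl⟩, hb⟩ := Metric.mem_closure_iff.1
    ((UniformSpace.Completion.denseRange_coe (α := WittRing F)) a) ε hε
  refine ⟨_, hξ ξ, fun φ => hεu ?_⟩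
  rw [← φ.2.1.banachHom_coe φ.2.2, dist_eq_norm, ← map_sub]
  rw [dist_eq_norm] at hb
  exact (φ.2.1.norm_banachHom_le φ.2.2 _).trans_lt hb

end TropicalSpectrum

namespace GelfandSpectrum

variable {F : Type u} [BanachSemifield F]

theorem continuous_eval {A : Type u} [CommRing A] [Algebra ℂ A] (a : A) :
    Continuous fun χ : GelfandSpectrum A => χ.eval a :=
  continuous_iInf_dom (i := a) continuous_induced_dom

/-- The restriction of a complex character to the real Witt Banach algebra. -/
noncomputable def toReal (χ : GelfandSpectrum (ℂ ⊗[ℝ] WittBanach F)) : WittBanach F →ₐ[ℝ] ℂ :=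
  (AlgHom.restrictScalars ℝ (show ℂ ⊗[ℝ] WittBanach F →ₐ[ℂ] ℂ from χ)).comp
    Algebra.TensorProduct.includeRight

theorem toReal_apply (χ : GelfandSpectrum (ℂ ⊗[ℝ] WittBanach F)) (a : WittBanach F) :
    χ.toReal a = χ.eval (1 ⊗ₜ a) := rfl

end GelfandSpectrum

/-! ### The homeomorphism -/

/-- The tropical spectrum is homeomorphic to the spectrum of the complexified Witt Banach
algebra. -/
noncomputable def tropicalHomeomorph (F : Type u) [BanachSemifield F] :
    TropicalSpectrum F ≃ₜ GelfandSpectrum (ℂ ⊗[ℝ] WittBanach F) where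
  toFun φ := φ.2.1.complexHom φ.2.2
  invFun χ := ⟨WittBanach.logChar χ.toReal, WittBanach.isTropicalCharacter_logChar _,
    WittBanach.logChar_E _⟩
  left_inv φ := by
    refine Subtype.ext (funext fun X => ?_)
    have h : GelfandSpectrum.toReal (φ.2.1.complexHom φ.2.2) (WittBanach.teichmuller X) =
        (Real.exp (φ.1 X) : ℝ) := by
      refine (φ.2.1.complexHom_tmul φ.2.2 1 _).trans ?_
      rw [one_mul, IsTropicalCharacter.banachHom_teichmuller]
    change WittBanach.logChar _ X = _
    rw [WittBanach.logChar, h, Complex.norm_real, Real.norm_of_nonneg (Real.exp_pos _).le,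
      Real.log_exp]
  right_inv χ := by
    -- Complex-linear homomorphisms on the complexification are determined by pure tensors, hence by
    -- their restriction to the real algebra, where `eq_banachHom_logChar` applies.
    refine Algebra.TensorProduct.ext' (S := ℂ) fun z a => ?_
    refine (IsTropicalCharacter.complexHom_tmul _ _ z a).trans ?_
    rw [← WittBanach.eq_banachHom_logChar, GelfandSpectrum.toReal_apply]
    have h : z ⊗ₜ[ℝ] a = z • ((1 : ℂ) ⊗ₜ[ℝ] a) := by
      rw [TensorProduct.smul_tmul', smul_eq_mul, mul_one]
    rw [h]
    exact (map_smul (show ℂ ⊗[ℝ] WittBanach F →ₐ[ℂ] ℂ from χ) z _).symm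
  continuous_toFun := by
    refine continuous_iInf_rng.2 fun a => continuous_induced_rng.2 ?_
    change Continuous fun φ : TropicalSpectrum F => φ.2.1.complexHom φ.2.2 a
    induction a using TensorProduct.induction_on with
    | zero => simpa only [map_zero] using continuous_const
    | tmul z a =>
      simp only [IsTropicalCharacter.complexHom_tmul]
      exact continuous_const.mul
        (Complex.continuous_ofReal.comp (TropicalSpectrum.continuous_banachHom_apply a))
    | add a b ha hb =>
      simp only [map_add]
      exact ha.add hb
  continuous_invFun := by
    refine continuous_iInf_rng.2 fun X => continuous_induced_rng.2 ?_
    -- The inverse is checked directly, without compactness: its `X`-coordinate is the logarithm of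
    -- the modulus of one nowhere vanishing evaluation.
    exact (GelfandSpectrum.continuous_eval _).norm.log
      fun χ => (WittBanach.norm_map_teichmuller_pos χ.toReal X).ne'

theorem theorem4p2 (F : Type u) [BanachSemifield F] :
    ∃ h : TropicalSpectrum F ≃ₜ GelfandSpectrum (ℂ ⊗[ℝ] WittBanach F),
      ∀ (φ : TropicalSpectrum F) (X : F),
        (h φ).eval (1 ⊗ₜ[ℝ] WittBanach.teichmuller X) = (Real.exp (φ.1 X) : ℂ) := by
  refine ⟨tropicalHomeomorph F, fun φ X => ?_⟩
  refine (φ.2.1.complexHom_tmul φ.2.2 1 _).trans ?_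
  rw [one_mul, IsTropicalCharacter.banachHom_teichmuller]
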